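/- For positive integers $s_1,\dots,s_k$ (with $s_1>1$ if $k\ge 1$) let $\zeta(s_1,\dots,s_k)=\sum_{n_1>n_2>\cdots>n_k>0}\prod_{j=1}^k n_j^{-s_j}$ be the multiple zeta value, the value at the empty string being $1$. For $r,k\ge 0$ let $C_r(k)$ be the set of ordered compositions of $k$ into $r$ non-negative integer parts. For a vector $\vec s=(m_0,m_1,\dots,m_{2n})$ of non-negative integers let $$Z(\vec s)=\zeta(\{2\}^{m_0},3,\{2\}^{m_1},1,\{2\}^{m_2},3,\{2\}^{m_3},1,\dots,3,\{2\}^{m_{2n-1}},1,\{2\}^{m_{2n}})$$ be the multiple zeta value obtained by inserting $m_j$ consecutive twos after the $j$-th element of the string $\{3,1\}^n=(3,1,\dots,3,1)$, for $j=0,\dots,2n$; in particular $Z(m)=\zeta(\{2\}^m)$. For words in the letters $a=dt/t$ and $b=dt/(1-t)$, let $\int_0^1\alpha_1\cdots\alpha_k=\int_{1>t_1>\cdots>t_k>0}\prod_{j=1}^k f_j(t_j)\,dt_j$, where $\alpha_j=f_j(t)\,dt$ (equal to $1$ for the empty word), and extend $\int_0^1$ linearly to $\mathbb Q\langle a,b\rangle$.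 The shuffle product $\sqcup\!\sqcup$ of words is given by $1\mathbin{\sqcup\!\sqcup} w=w\mathbin{\sqcup\!\sqcup} 1=w$ and $xu\mathbin{\sqcup\!\sqcup} yv=x(u\mathbin{\sqcup\!\sqcup} yv)+y(xu\mathbin{\sqcup\!\sqcup} v)$ for letters $x,y$ and words $u,v,w$. For integers $m\ge n\ge 0$ let $S_{m,n}$ be the set of words occurring in $(ab)^n\mathbin{\sqcup\!\sqcup} (ab)^{m-n}$ in which the subword $a^2$ (two consecutive letters $a$) appears exactly $n$ times, and let $T_{m,n}\in\mathbb Q\langle a,b\rangle$ be the sum of the distinct words in $S_{m,n}$. Then, for all integers $m\ge 2n\ge 0$, all the series $Z(\vec s)$ with $\vec s\in C_{2n+1}(m-2n)$ and all the integrals $\int_0^1 w$ with $w\in S_{m,n}$ converge absolutely, and $$\sum_{\vec s\in C_{2n+1}(m-2n)}Z(\vec s)=\int_0^1T_{m,n}=\frac{Z(m)}{2n+1}\binom{m}{2n}=\frac{2\pi^{2m}}{(2m+2)!}\binom{m+1}{2n+1}.$$ In particular (the case $m=2n$), $\zeta(\{3,1\}^n)=\dfrac{2\pi^{4n}}{(4n+2)!}$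 for every integer $n\ge 0$, where the series converges. -/

import Mathlib

namespace MZV

noncomputable section

/-- The term `∏ⱼ nⱼ ^ (-sⱼ)` of the nested series, indexed by the tuples
`n₁ > n₂ > ⋯ > n_k > 0` of positive integers. -/
def zetaTerm (s : List ℕ) (n : {n : Fin s.length → ℕ+ // StrictAnti n}) : ℝ :=
  ∏ j : Fin s.length, (((n.1 j : ℕ) : ℝ) ^ s.get j)⁻¹

/-- The multiple zeta value `ζ(s₁, …, s_k) = ∑_{n₁ > ⋯ > n_k > 0} ∏ⱼ nⱼ ^ (-sⱼ)`
(so that `ζ()` of the empty list is `1`). -/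
def zeta (s : List ℕ) : ℝ :=
  ∑' n : {n : Fin s.length → ℕ+ // StrictAnti n}, zetaTerm s n

/-- The argument string `{2}^{m₀}, 3, {2}^{m₁}, 1, {2}^{m₂}, …, 3, {2}^{m_{2n-1}}, 1, {2}^{m_{2n}}`
obtained by inserting `mⱼ` twos after the `j`th element of `{3,1}^n`. -/
def insertTwos {n : ℕ} (s : Fin (2 * n + 1) → ℕ) : List ℕ :=
  List.replicate (s 0) 2 ++ (List.finRange n).flatMap fun k =>
    (3 :: List.replicate (s ⟨2 * k.1 + 1, by omega⟩) 2) ++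
      (1 :: List.replicate (s ⟨2 * k.1 + 2, by omega⟩) 2)

/-- `Z(m₀, …, m_{2n})`. -/
def Z {n : ℕ} (s : Fin (2 * n + 1) → ℕ) : ℝ :=
  zeta (insertTwos s)

/-- The value `Z(m)` at a vector with the single entry `m` (the case `n = 0`). -/
def Z₁ (m : ℕ) : ℝ :=
  Z (n := 0) fun _ => m

/-- `C_r(k)`: the ordered compositions of `k` into `r` non-negative integer parts. -/
def C (r k : ℕ) : Finset (Fin r → ℕ) :=
  Finset.Nat.antidiagonalTuple r k

/-- The two-letter alphabet. -/
inductive Letter : Type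
  | a : Letter
  | b : Letter
  deriving DecidableEq

/-- The density of the differential form attached to a letter: `a = dt / t`, `b = dt / (1 - t)`. -/
def Letter.density : Letter → ℝ → ℝ
  | .a, t => 1 / t
  | .b, t => 1 / (1 - t)

/-- The open simplex `1 > t₁ > t₂ > ⋯ > t_k > 0`. -/
def simplex (k : ℕ) : Set (Fin k → ℝ) :=
  {t | StrictAnti t ∧ ∀ j, 0 < t j ∧ t j < 1}

/-- The integrand `∏ⱼ fⱼ(tⱼ)` belonging to a word. -/
def integrand (w : List Letter) (t : Fin w.length → ℝ) : ℝ :=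
  ∏ j : Fin w.length, (w.get j).density (t j)

/-- The iterated integral `∫₀¹ w` of a word `w` (equal to `1` for the empty word). -/
def wordIntegral (w : List Letter) : ℝ :=
  ∫ t in simplex w.length, integrand w t

/-- The non-commutative polynomial ring `ℚ⟨a, b⟩`: its basis is the free monoid of words. -/
abbrev NCPoly : Type := MonoidAlgebra ℚ (FreeMonoid Letter)

/-- A word, as an element of `ℚ⟨a, b⟩`. -/
def word (w : List Letter) : NCPoly :=
  MonoidAlgebra.single (FreeMonoid.ofList w) 1

/-- The linear extension of the iterated integral `∫₀¹` to `ℚ⟨a, b⟩`. -/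
def polyIntegral (P : NCPoly) : ℝ :=
  P.coeff.sum fun w c => (c : ℝ) * wordIntegral w.toList

/-- The shuffle product of two words:
`1 ⧢ w = w ⧢ 1 = w` and `xu ⧢ yv = x(u ⧢ yv) + y(xu ⧢ v)`. -/
def shuffle : List Letter → List Letter → NCPoly
  | [], w => word w
  | x :: u, [] => word (x :: u)
  | x :: u, y :: v =>
      word [x] * shuffle u (y :: v) + word [y] * shuffle (x :: u) v
  termination_by u v => u.length + v.length

/-- The word `(ab)^n`. -/
def abPow (n : ℕ) : List Letter :=
  (List.replicate n [Letter.a, Letter.b]).flatten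

/-- The number of occurrences of `a²` as a (contiguous) subword: the number of positions at which
`aa` starts. -/
def countAA (w : List Letter) : ℕ :=
  w.tails.countP fun t => [Letter.a, Letter.a].isPrefixOf t

/-- `S_{m,n}` (for `m ≥ n ≥ 0`): the words occurring in `(ab)^n ⧢ (ab)^{m-n}` in which `a²`
appears exactly `n` times. -/
def S (m n : ℕ) : Finset (FreeMonoid Letter) :=
  (shuffle (abPow n) (abPow (m - n))).coeff.support.filter fun w => countAA w.toList = n

/-- `T_{m,n}`: the sum of the distinct words in `S_{m,n}` if `m ≥ n`, and `0` otherwise. -/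
def T (m n : ℕ) : NCPoly :=
  if n ≤ m then ∑ w ∈ S m n, word w.toList else 0

/-- The argument string `{3,1}^n`. -/
def threeOne (n : ℕ) : List ℕ :=
  (List.replicate n [3, 1]).flatten

end

end MZV

/-! ### Shuffles, argument strings and words -/

namespace MZV

/-! Write `T_{m,k}` for the sum of the words `oddWord k s`, `s ∈ C (2k+1) (m-2k)`. The core is the
identity `(ab)^n ⧢ (ab)^p = ∑_{k ≤ n} 4^k (n+p-2k choose n-k) T_{n+p,k}` for `n ≤ p`
(`shuffleSum_abPow`, `shuffleCoeff_eq`). It also shows that the words with exactly `n` subwords `aa`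
are the words of the `Z(s)` (`S_eq_image`).

Iterated integrals turn shuffles into products (`iterLintegral_mul`), and expanding in power series
identifies them with multiple zeta values (`iterLintegral_zetaWord_one`, `tsum_ofReal_zetaTerm`).
Euler's product gives `∫ (ab)^n = ζ({2}^n) = π^{2n}/(2n+1)!` (`tsum_zetaCoeff_replicate_two`). For
fixed `m`, integrating the core identity with `p = m - n` is a triangular system in the `∫ T_{m,k}`
with diagonal entries `4^n`. The claimed values solve it, because `(1+X)^{2m+2} = (2X +
(1+X²))^{m+1}` (`sum_four_pow_mul_choose`).

Sums and integrals are taken in `[0, ∞]`, so no convergence is presupposed; it follows from the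
finiteness of the resulting totals. -/

/-- The sum of `g` over the words of the shuffle product of two words, with multiplicity. -/
def shuffleSum {M : Type*} [AddCommMonoid M] :
    List Letter → List Letter → (List Letter → M) → M
  | [], w, g => g w
  | x :: u, [], g => g (x :: u)
  | x :: u, y :: v, g =>
      shuffleSum u (y :: v) (fun w => g (x :: w)) + shuffleSum (x :: u) v (fun w => g (y :: w))
  termination_by u v => u.length + v.length

section ShuffleSum

variable {M : Type*} [AddCommMonoid M]

theorem shuffleSum_nil_left (w : List Letter) (g : List Letter → M) :
    shuffleSum [] w g = g w := by
  rw [shuffleSum]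

theorem shuffleSum_nil_right (w : List Letter) (g : List Letter → M) :
    shuffleSum w [] g = g w := by
  cases w <;> rw [shuffleSum]

theorem shuffleSum_cons_cons (x y : Letter) (u v : List Letter) (g : List Letter → M) :
    shuffleSum (x :: u) (y :: v) g =
      shuffleSum u (y :: v) (fun w => g (x :: w)) +
        shuffleSum (x :: u) v (fun w => g (y :: w)) := by
  rw [shuffleSum]

theorem map_shuffleSum {N : Type*} [AddCommMonoid N] (φ : M →+ N) (u v : List Letter)
    (g : List Letter → M) :
    φ (shuffleSum u v g) = shuffleSum u v fun w => φ (g w) := by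
  induction u, v, g using shuffleSum.induct with
  | case1 w g => simp only [shuffleSum_nil_left]
  | case2 x u g => simp only [shuffleSum_nil_right]
  | case3 x u y v g ih₁ ih₂ => rw [shuffleSum_cons_cons, map_add, ih₁, ih₂, shuffleSum_cons_cons]

theorem word_append (u v : List Letter) : word (u ++ v) = word u * word v := by
  simp [word, MonoidAlgebra.single_mul_single]

/-- With `g = word` the sum is the shuffle in `ℚ⟨a,b⟩`; with `g` an iterated integral it is the
integrated shuffle. One combinatorial identity for arbitrary `g` serves both. -/
theorem shuffle_eq_shuffleSum (u v : List Letter) : shuffle u v = shuffleSum u v word := by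
  induction u, v using shuffle.induct with
  | case1 w => rw [shuffle, shuffleSum_nil_left]
  | case2 x u => rw [shuffle, shuffleSum_nil_right]
  | case3 x u y v ih₁ ih₂ =>
    rw [shuffle, shuffleSum_cons_cons, ih₁, ih₂]
    have h (z : Letter) (u v : List Letter) :
        word [z] * shuffleSum u v word = shuffleSum u v fun w => word (z :: w) := by
      have := map_shuffleSum (AddMonoidHom.mulLeft (word [z])) u v word
      simpa [← word_append] using this
    rw [h, h]

end ShuffleSum

/-- The word `a^{s₁-1} b ⋯ a^{s_k-1} b` whose iterated integral is `ζ(s₁, …, s_k)`. -/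
def zetaWord (s : List ℕ) : List Letter :=
  s.flatMap fun k => List.replicate (k - 1) Letter.a ++ [Letter.b]

theorem zetaWord_append (s t : List ℕ) : zetaWord (s ++ t) = zetaWord s ++ zetaWord t := by
  simp [zetaWord]

theorem zetaWord_replicate_two (n : ℕ) : zetaWord (List.replicate n 2) = abPow n := by
  induction n with
  | zero => rfl
  | succ n ih =>
    rw [List.replicate_succ, zetaWord, List.flatMap_cons, ← zetaWord, ih]
    rfl

theorem abPow_succ (n : ℕ) : abPow (n + 1) = Letter.a :: Letter.b :: abPow n := rfl

/-- The word of the argument string `insertTwos s`. -/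
def oddWord (n : ℕ) (s : Fin (2 * n + 1) → ℕ) : List Letter :=
  zetaWord (insertTwos s)

/-- The part of the word of an argument string `insertTwos` that follows a prefix ending in
the letters `aab` of an argument `3`. -/
def evenWord (n : ℕ) (s : Fin (2 * n + 2) → ℕ) : List Letter :=
  abPow (s 0) ++ Letter.b :: oddWord n (Fin.tail s)

theorem insertTwos_succ (n : ℕ) (s : Fin (2 * (n + 1) + 1) → ℕ) :
    insertTwos s = List.replicate (s 0) 2 ++ 3 :: (List.replicate (s 1) 2 ++
      1 :: insertTwos (n := n) fun i => s i.succ.succ) := by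
  rw [insertTwos, List.finRange_succ, List.flatMap_cons, List.flatMap_map, insertTwos]
  simp only [List.cons_append, List.append_assoc]
  rfl

theorem oddWord_zero (s : Fin 1 → ℕ) : oddWord 0 s = abPow (s 0) := by
  simp [oddWord, insertTwos, zetaWord_replicate_two]

theorem oddWord_succ (n : ℕ) (s : Fin (2 * n + 3) → ℕ) :
    oddWord (n + 1) s =
      abPow (s 0) ++ Letter.a :: Letter.a :: Letter.b :: evenWord n (Fin.tail s) := by
  rw [oddWord, insertTwos_succ, zetaWord_append, zetaWord_replicate_two, zetaWord,
    List.flatMap_cons, ← zetaWord, zetaWord_append, zetaWord_replicate_two, zetaWord,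
    List.flatMap_cons, ← zetaWord]
  rfl

/-! ### Sums over compositions and their first-letter recursions -/

section Compositions

variable {M : Type*} [AddCommMonoid M]

theorem sum_C_succ (r m : ℕ) (f : (Fin (r + 1) → ℕ) → M) :
    ∑ s ∈ C (r + 1) m, f s =
      ∑ p ∈ Finset.HasAntidiagonal.antidiagonal m, ∑ s ∈ C r p.2, f (Fin.cons p.1 s) := by
  rw [Finset.sum_sigma']
  refine Finset.sum_bij' (fun s _ => ⟨(s 0, ∑ i, Fin.tail s i), Fin.tail s⟩)
    (fun x _ => Fin.cons x.1.1 x.2) ?_ ?_ ?_ ?_ ?_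
  · intro s hs
    simpa [C, Finset.Nat.mem_antidiagonalTuple, Fin.sum_univ_succ, Fin.tail] using hs
  · rintro ⟨⟨i, j⟩, s⟩ hs
    simp only [C, Finset.mem_sigma, Finset.HasAntidiagonal.mem_antidiagonal,
      Finset.Nat.mem_antidiagonalTuple] at hs ⊢
    rw [Fin.sum_univ_succ]
    simp [hs.1, hs.2]
  · intro s _
    simp
  · rintro ⟨⟨i, j⟩, s⟩ hs
    simp only [C, Finset.mem_sigma, Finset.HasAntidiagonal.mem_antidiagonal,
      Finset.Nat.mem_antidiagonalTuple] at hs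
    simp [hs.2]
  · intro s _
    simp

/-- The sum of `g` over the words of length `2 * m` of the shape `oddWord n s`. -/
def oddSum (n m : ℕ) (g : List Letter → M) : M :=
  if 2 * n ≤ m then ∑ s ∈ C (2 * n + 1) (m - 2 * n), g (oddWord n s) else 0

/-- The sum of `g` over the words of length `2 * m + 1` of the shape `evenWord n s`. -/
def evenSum (n m : ℕ) (g : List Letter → M) : M :=
  if 2 * n ≤ m then ∑ s ∈ C (2 * n + 2) (m - 2 * n), g (evenWord n s) else 0

theorem oddSum_eq_zero (m : ℕ) (g : List Letter → M) (n : ℕ) (h : m < 2 * n) :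
    oddSum n m g = 0 :=
  if_neg h.not_ge

theorem evenSum_eq_zero (m : ℕ) (g : List Letter → M) (n : ℕ) (h : m < 2 * n) :
    evenSum n m g = 0 :=
  if_neg h.not_ge

theorem C_one (m : ℕ) : C 1 m = {fun _ => m} := by
  rw [C, Finset.Nat.antidiagonalTuple_one]
  congr 1
  funext i
  fin_cases i
  rfl

theorem oddSum_zero (m : ℕ) (g : List Letter → M) : oddSum 0 m g = g (abPow m) := by
  have h : C 1 m = {fun _ => m} := C_one m
  simp [oddSum, h, oddWord_zero]

/-- Sort by the first entry of the composition: if positive, the word starts with `ab` and the entry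
drops by one; if zero, it starts with the `aab` of the first `3`. -/
theorem oddSum_succ_add_two (n m : ℕ) (g : List Letter → M) :
    oddSum (n + 1) (m + 2) g =
      oddSum (n + 1) (m + 1) (fun w => g (Letter.a :: Letter.b :: w)) +
        evenSum n m (fun w => g (Letter.a :: Letter.a :: Letter.b :: w)) := by
  have key (j : ℕ) (g : List Letter → M) : ∑ s ∈ C (2 * (n + 1) + 1) j, g (oddWord (n + 1) s) =
      ∑ p ∈ Finset.HasAntidiagonal.antidiagonal j, ∑ s ∈ C (2 * n + 2) p.2,
        g (abPow p.1 ++ Letter.a :: Letter.a :: Letter.b :: evenWord n s) := by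
    refine (sum_C_succ _ _ _).trans ?_
    refine Finset.sum_congr rfl fun p _ => Finset.sum_congr rfl fun s _ => ?_
    rw [oddWord_succ]
    simp
  unfold oddSum evenSum
  rcases Nat.lt_or_ge m (2 * n) with h | h
  · rw [if_neg (by omega), if_neg (by omega), if_neg (by omega), add_zero]
  · obtain ⟨j, rfl⟩ := Nat.exists_eq_add_of_le h
    cases j with
    | zero =>
      -- Only the zero composition remains, so no word starts with `ab`.
      rw [if_pos (by omega), if_neg (by omega), if_pos (by omega), key,
        show 2 * n + 0 + 2 - 2 * (n + 1) = 0 by omega]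
      simp [abPow]
    | succ j =>
      rw [if_pos (by omega), if_pos (by omega), if_pos (by omega),
        show 2 * n + (j + 1) + 2 - 2 * (n + 1) = j + 1 by omega,
        show 2 * n + (j + 1) + 1 - 2 * (n + 1) = j by omega,
        show 2 * n + (j + 1) - 2 * n = j + 1 by omega, key,
        key j fun w => g (Letter.a :: Letter.b :: w), Finset.Nat.sum_antidiagonal_succ, add_comm]
      rfl

theorem sum_C_evenWord (n j : ℕ) (g : List Letter → M) :
    ∑ s ∈ C (2 * n + 2) j, g (evenWord n s) =
      ∑ p ∈ Finset.HasAntidiagonal.antidiagonal j, ∑ s ∈ C (2 * n + 1) p.2,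
        g (abPow p.1 ++ Letter.b :: oddWord n s) := by
  refine (sum_C_succ _ _ _).trans ?_
  refine Finset.sum_congr rfl fun p _ => Finset.sum_congr rfl fun s _ => ?_
  simp [evenWord]

theorem evenSum_zero (n : ℕ) (g : List Letter → M) :
    evenSum n 0 g = oddSum n 0 (fun w => g (Letter.b :: w)) := by
  unfold oddSum evenSum
  rw [sum_C_evenWord]
  simp [abPow]

/-- Again by the first entry: positive gives a leading `ab`, zero gives the `b` of the next argument
`1`. -/
theorem evenSum_succ (n m : ℕ) (g : List Letter → M) :
    evenSum n (m + 1) g =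
      evenSum n m (fun w => g (Letter.a :: Letter.b :: w)) +
        oddSum n (m + 1) (fun w => g (Letter.b :: w)) := by
  unfold oddSum evenSum
  rcases Nat.lt_or_ge m (2 * n) with h | h
  · by_cases h' : 2 * n ≤ m + 1
    · rw [if_pos h', if_neg (by omega), if_pos h', show m + 1 - 2 * n = 0 by omega,
        sum_C_evenWord]
      simp [abPow]
    · rw [if_neg h', if_neg (by omega), if_neg h', add_zero]
  · obtain ⟨j, rfl⟩ := Nat.exists_eq_add_of_le h
    rw [if_pos (by omega), if_pos (by omega), if_pos (by omega), sum_C_evenWord,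
      sum_C_evenWord n _ fun w => g (Letter.a :: Letter.b :: w),
      show 2 * n + j + 1 - 2 * n = j + 1 by omega, show 2 * n + j - 2 * n = j by omega,
      Finset.Nat.sum_antidiagonal_succ, add_comm]
    rfl

end Compositions

/-! ### Multiplicities -/

/-- The multiplicity in `(ab)^n ⧢ (ab)^p` of the words in which `aa` appears `k` times. -/
def shuffleCoeff : ℕ → ℕ → ℕ → ℕ
  | 0, n, p => (n + p).choose n
  | _ + 1, 0, _ => 0
  | _ + 1, _ + 1, 0 => 0
  | k + 1, n + 1, p + 1 => 4 * shuffleCoeff k n p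

theorem shuffleCoeff_succ_zero (k n : ℕ) : shuffleCoeff (k + 1) n 0 = 0 := by
  cases n <;> rfl

theorem shuffleCoeff_eq {k n p : ℕ} (hn : k ≤ n) (hp : k ≤ p) :
    shuffleCoeff k n p = 4 ^ k * (n + p - 2 * k).choose (n - k) := by
  induction k generalizing n p with
  | zero => simp [shuffleCoeff]
  | succ k ih =>
    obtain ⟨n, rfl⟩ : ∃ j, n = j + 1 := ⟨n - 1, by omega⟩
    obtain ⟨p, rfl⟩ : ∃ j, p = j + 1 := ⟨p - 1, by omega⟩
    rw [shuffleCoeff, ih (by omega) (by omega), show n + 1 + (p + 1) - 2 * (k + 1) = n + p - 2 * k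
      by omega, Nat.add_sub_add_right]
    ring

/-- Pascal's rule for `(n+p+2-2k choose n+1-k)`. The bound excludes `k = n+1 = p+1`, where the left
side is `4^k` and the right side `0`. -/
theorem shuffleCoeff_pascal {k n p : ℕ} (h : 2 * k ≤ n + p + 1) :
    shuffleCoeff k (n + 1) (p + 1) = shuffleCoeff k n (p + 1) + shuffleCoeff k (n + 1) p := by
  induction k generalizing n p with
  | zero =>
    simp only [shuffleCoeff]
    rw [show n + 1 + (p + 1) = (n + p + 1) + 1 by ring, Nat.choose_succ_succ]
    congr 2; ring
  | succ k ih =>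
    rw [shuffleCoeff]
    cases n with
    | zero =>
      cases p with
      | zero => omega
      | succ p =>
        rw [shuffleCoeff, shuffleCoeff]
        cases k with
        | zero => simp [shuffleCoeff]
        | succ k => simp [shuffleCoeff]
    | succ n =>
      cases p with
      | zero =>
        rw [shuffleCoeff, shuffleCoeff]
        cases k with
        | zero => simp [shuffleCoeff]
        | succ k => simp [shuffleCoeff_succ_zero]
      | succ p =>
        rw [shuffleCoeff, shuffleCoeff, ih (by omega)]
        ring

theorem shuffleCoeff_zero_left (k p : ℕ) : shuffleCoeff k 0 p = if k = 0 then 1 else 0 := by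
  cases k <;> simp [shuffleCoeff]

theorem shuffleCoeff_zero_right (k n : ℕ) : shuffleCoeff k n 0 = if k = 0 then 1 else 0 := by
  cases k <;> simp [shuffleCoeff, shuffleCoeff_succ_zero]

/-! ### The shuffle product of two powers of `ab` -/

section ShuffleSum

variable {M : Type*} [AddCommMonoid M]

/-- The sum of `g` over the shuffle products that remain of `(ab)^(n+1) ⧢ (ab)^p` and
`(ab)^n ⧢ (ab)^(p+1)` after the first letter of the higher power. -/
def openShuffleSum (n p : ℕ) (g : List Letter → M) : M :=
  shuffleSum (Letter.b :: abPow n) (abPow p) g + shuffleSum (abPow n) (Letter.b :: abPow p) g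

/-- After the first `a`, the next letter is the `b` of the same factor or the `a` of the other. In
the latter case both factors start with `b`, so a third letter `b` is forced; the two orders of
taking the `a`s give the factor `2`. -/
theorem shuffleSum_abPow_succ_succ (n p : ℕ) (g : List Letter → M) :
    shuffleSum (abPow (n + 1)) (abPow (p + 1)) g =
      shuffleSum (abPow n) (abPow (p + 1)) (fun w => g (Letter.a :: Letter.b :: w)) +
        shuffleSum (abPow (n + 1)) (abPow p) (fun w => g (Letter.a :: Letter.b :: w)) +
        2 • openShuffleSum n p (fun w => g (Letter.a :: Letter.a :: Letter.b :: w)) := by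
  simp only [abPow_succ, shuffleSum_cons_cons, openShuffleSum, two_nsmul]
  abel

theorem openShuffleSum_zero_zero (g : List Letter → M) :
    openShuffleSum 0 0 g = 2 • g [Letter.b] := by
  simp [openShuffleSum, abPow, shuffleSum_nil_left, shuffleSum_nil_right, two_nsmul]

theorem openShuffleSum_succ_zero (n : ℕ) (g : List Letter → M) :
    openShuffleSum (n + 1) 0 g =
      2 • g (Letter.b :: abPow (n + 1)) +
        openShuffleSum n 0 (fun w => g (Letter.a :: Letter.b :: w)) := by
  simp only [openShuffleSum, abPow_succ, shuffleSum_cons_cons, two_nsmul,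
    show abPow 0 = [] from rfl, shuffleSum_nil_right]
  abel

theorem openShuffleSum_zero_succ (p : ℕ) (g : List Letter → M) :
    openShuffleSum 0 (p + 1) g =
      2 • g (Letter.b :: abPow (p + 1)) +
        openShuffleSum 0 p (fun w => g (Letter.a :: Letter.b :: w)) := by
  simp only [openShuffleSum, abPow_succ, shuffleSum_cons_cons, two_nsmul,
    show abPow 0 = [] from rfl, shuffleSum_nil_left]
  abel

/-- If the first letter is an `a`, both remaining factors start with `b`, so `ab` is forced and what
is left is again an open shuffle. -/
theorem openShuffleSum_succ_succ (n p : ℕ) (g : List Letter → M) :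
    openShuffleSum (n + 1) (p + 1) g =
      2 • shuffleSum (abPow (n + 1)) (abPow (p + 1)) (fun w => g (Letter.b :: w)) +
        (openShuffleSum n (p + 1) (fun w => g (Letter.a :: Letter.b :: w)) +
          openShuffleSum (n + 1) p (fun w => g (Letter.a :: Letter.b :: w))) := by
  simp only [openShuffleSum, abPow_succ, shuffleSum_cons_cons, two_nsmul]
  abel

theorem sum_shuffleCoeff_boundary {K : ℕ} (hK : 0 < K) {c : ℕ → ℕ}
    (hc : ∀ k, c k = if k = 0 then 1 else 0) (f : ℕ → M) :
    ∑ k ∈ Finset.range K, c k • f k = f 0 := by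
  rw [Finset.sum_eq_single_of_mem 0 (Finset.mem_range.2 hK)]
  · simp [hc]
  · intro k _ hk
    simp [hc, hk]

/-- The index at which Pascal's rule can fail is killed by `f`: it would need more `3`s and `1`s
than the word length allows. -/
theorem sum_shuffleCoeff_pascal (K n p : ℕ) (f : ℕ → M) (hf : ∀ k, n + p + 1 < 2 * k → f k = 0) :
    ∑ k ∈ Finset.range K, shuffleCoeff k (n + 1) (p + 1) • f k =
      ∑ k ∈ Finset.range K, shuffleCoeff k n (p + 1) • f k +
        ∑ k ∈ Finset.range K, shuffleCoeff k (n + 1) p • f k := by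
  rw [← Finset.sum_add_distrib]
  refine Finset.sum_congr rfl fun k _ => ?_
  rcases Nat.lt_or_ge (n + p + 1) (2 * k) with h | h
  · simp [hf k h]
  · rw [shuffleCoeff_pascal h, add_smul]

/-- The `k = 0` word never starts with `aab`. For the others the `aab` part shifts `k` by one, and
the recursion of `shuffleCoeff` supplies the `4`. -/
theorem sum_shuffleCoeff_oddSum_succ_succ (K n p : ℕ) (g : List Letter → M) :
    ∑ k ∈ Finset.range (K + 1), shuffleCoeff k (n + 1) (p + 1) • oddSum k (n + p + 2) g =
      ∑ k ∈ Finset.range (K + 1), shuffleCoeff k n (p + 1) •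
          oddSum k (n + p + 1) (fun w => g (Letter.a :: Letter.b :: w)) +
        ∑ k ∈ Finset.range (K + 1), shuffleCoeff k (n + 1) p •
          oddSum k (n + p + 1) (fun w => g (Letter.a :: Letter.b :: w)) +
        4 • ∑ k ∈ Finset.range K, shuffleCoeff k n p •
          evenSum k (n + p) (fun w => g (Letter.a :: Letter.a :: Letter.b :: w)) := by
  rw [← sum_shuffleCoeff_pascal _ _ _ _ (oddSum_eq_zero (n + p + 1) _),
    Finset.sum_range_succ', Finset.sum_range_succ' _ K, Finset.smul_sum,
    add_right_comm (Finset.sum _ _),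
    ← Finset.sum_add_distrib]
  congr 1
  · refine Finset.sum_congr rfl fun k _ => ?_
    rw [oddSum_succ_add_two, smul_add, shuffleCoeff, mul_smul, mul_smul]
  · simp only [oddSum_zero, abPow_succ]

theorem sum_shuffleCoeff_evenSum_succ_succ (K n p : ℕ) (g : List Letter → M) :
    ∑ k ∈ Finset.range K, shuffleCoeff k (n + 1) (p + 1) • evenSum k (n + p + 2) g =
      ∑ k ∈ Finset.range K, shuffleCoeff k (n + 1) (p + 1) •
          oddSum k (n + p + 2) (fun w => g (Letter.b :: w)) +
        (∑ k ∈ Finset.range K, shuffleCoeff k n (p + 1) •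
            evenSum k (n + p + 1) (fun w => g (Letter.a :: Letter.b :: w)) +
          ∑ k ∈ Finset.range K, shuffleCoeff k (n + 1) p •
            evenSum k (n + p + 1) (fun w => g (Letter.a :: Letter.b :: w))) := by
  rw [← sum_shuffleCoeff_pascal _ _ _ _ (evenSum_eq_zero (n + p + 1) _),
    ← Finset.sum_add_distrib]
  refine Finset.sum_congr rfl fun k _ => ?_
  rw [evenSum_succ, smul_add, add_comm]

theorem evenSum_zero_zero (g : List Letter → M) : evenSum 0 0 g = g [Letter.b] := by
  rw [evenSum_zero, oddSum_zero]
  rfl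

theorem evenSum_zero_succ (m : ℕ) (g : List Letter → M) :
    evenSum 0 (m + 1) g = evenSum 0 m (fun w => g (Letter.a :: Letter.b :: w)) +
      g (Letter.b :: abPow (m + 1)) := by
  rw [evenSum_succ, oddSum_zero]

theorem openShuffleSum_zero_right (n : ℕ) (g : List Letter → M) :
    openShuffleSum n 0 g = 2 • evenSum 0 n g := by
  induction n generalizing g with
  | zero => rw [openShuffleSum_zero_zero, evenSum_zero_zero]
  | succ n ih => rw [openShuffleSum_succ_zero, ih, evenSum_zero_succ, smul_add, add_comm]

theorem openShuffleSum_zero_left (p : ℕ) (g : List Letter → M) :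
    openShuffleSum 0 p g = 2 • evenSum 0 p g := by
  induction p generalizing g with
  | zero => rw [openShuffleSum_zero_zero, evenSum_zero_zero]
  | succ n ih => rw [openShuffleSum_zero_succ, ih, evenSum_zero_succ, smul_add, add_comm]

/-- Peeling letters off either kind of shuffle produces the other, so both formulas are proved in
one induction. The `2` in front of the open shuffle and the `2` from the order of the `a`s make the
`4`. The free bound `K > n` lets recursive calls with different `n` share a range. -/
theorem shuffleSum_abPow_and_openShuffleSum (n p : ℕ) :
    ∀ K, n < K → ∀ g : List Letter → M,
      shuffleSum (abPow n) (abPow p) g =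
          ∑ k ∈ Finset.range K, shuffleCoeff k n p • oddSum k (n + p) g ∧
        openShuffleSum n p g =
          2 • ∑ k ∈ Finset.range K, shuffleCoeff k n p • evenSum k (n + p) g := by
  induction n generalizing p with
  | zero =>
    intro K hK g
    rw [sum_shuffleCoeff_boundary hK fun k => shuffleCoeff_zero_left k p,
      sum_shuffleCoeff_boundary hK fun k => shuffleCoeff_zero_left k p, zero_add, oddSum_zero,
      openShuffleSum_zero_left]
    exact ⟨shuffleSum_nil_left _ _, rfl⟩
  | succ n ihn =>
    induction p with
    | zero =>
      intro K hK g
      have hK' : 0 < K := by omega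
      rw [sum_shuffleCoeff_boundary hK' fun k => shuffleCoeff_zero_right k (n + 1),
        sum_shuffleCoeff_boundary hK' fun k => shuffleCoeff_zero_right k (n + 1), add_zero,
        oddSum_zero, openShuffleSum_zero_right]
      exact ⟨shuffleSum_nil_right _ _, rfl⟩
    | succ p ihp =>
      intro K hK
      obtain ⟨K, rfl⟩ : ∃ j, K = j + 1 := ⟨K - 1, by omega⟩
      have e₁ : n + 1 + (p + 1) = n + p + 2 := by omega
      have e₂ : n + (p + 1) = n + p + 1 := by omega
      have e₃ : n + 1 + p = n + p + 1 := by omega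
      have hodd (g : List Letter → M) : shuffleSum (abPow (n + 1)) (abPow (p + 1)) g =
          ∑ k ∈ Finset.range (K + 1),
            shuffleCoeff k (n + 1) (p + 1) • oddSum k (n + p + 2) g := by
        rw [shuffleSum_abPow_succ_succ, (ihn (p + 1) (K + 1) (by omega) _).1,
          (ihp (K + 1) hK _).1, (ihn p K (by omega) _).2, sum_shuffleCoeff_oddSum_succ_succ,
          smul_smul, e₂, e₃]
        norm_num
      intro g
      refine ⟨by rw [hodd, e₁], ?_⟩
      rw [openShuffleSum_succ_succ, hodd, (ihn (p + 1) (K + 1) (by omega) _).2,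
        (ihp (K + 1) hK _).2, e₁, sum_shuffleCoeff_evenSum_succ_succ, e₂, e₃]
      simp only [smul_add]

/-- The shuffle product of two powers of `ab`, sorted by the number of subwords `aa`. -/
theorem shuffleSum_abPow (n p : ℕ) (g : List Letter → M) :
    shuffleSum (abPow n) (abPow p) g =
      ∑ k ∈ Finset.range (n + 1), shuffleCoeff k n p • oddSum k (n + p) g :=
  (shuffleSum_abPow_and_openShuffleSum n p (n + 1) n.lt_succ_self g).1

end ShuffleSum

end MZV

/-! ### The words of `S_{m,n}` and the integral of `T_{m,n}` -/

namespace MZV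

theorem countAA_nil : countAA [] = 0 := by
  simp [countAA, List.isPrefixOf]

theorem countAA_cons_b (w : List Letter) : countAA (Letter.b :: w) = countAA w := by
  simp [countAA, List.isPrefixOf]

theorem countAA_cons_a_b (w : List Letter) :
    countAA (Letter.a :: Letter.b :: w) = countAA w := by
  rw [← countAA_cons_b w]
  simp [countAA, List.isPrefixOf]

theorem countAA_cons_a_a (w : List Letter) :
    countAA (Letter.a :: Letter.a :: w) = countAA (Letter.a :: w) + 1 := by
  simp [countAA, List.isPrefixOf]

theorem countAA_abPow_append (n : ℕ) (w : List Letter) : countAA (abPow n ++ w) = countAA w := by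
  induction n with
  | zero => rfl
  | succ n ih => rw [abPow_succ, List.cons_append, List.cons_append, countAA_cons_a_b, ih]

theorem countAA_oddWord (n : ℕ) (s : Fin (2 * n + 1) → ℕ) : countAA (oddWord n s) = n := by
  induction n with
  | zero => rw [oddWord_zero, ← List.append_nil (abPow _), countAA_abPow_append, countAA_nil]
  | succ n ih =>
    rw [oddWord_succ, countAA_abPow_append, countAA_cons_a_a, countAA_cons_a_b, evenWord,
      countAA_abPow_append, countAA_cons_b, ih]

/-- Since neither remainder starts with `ab`, the power is the maximal run of leading `ab`s and can
be read off the word. -/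
theorem abPow_append_inj {i j : ℕ} {u v : List Letter}
    (hu : ∀ w, u ≠ Letter.a :: Letter.b :: w) (hv : ∀ w, v ≠ Letter.a :: Letter.b :: w)
    (h : abPow i ++ u = abPow j ++ v) : i = j ∧ u = v := by
  induction i generalizing j with
  | zero =>
    cases j with
    | zero => exact ⟨rfl, h⟩
    | succ j => exact absurd h (hu _)
  | succ i ih =>
    cases j with
    | zero => exact absurd h.symm (hv _)
    | succ j =>
      simp only [abPow_succ, List.cons_append, List.cons.injEq, true_and] at h
      exact (ih h).imp_left (congrArg _)

/-- Ensures that summing distinct words is the same as summing over compositions. -/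
theorem oddWord_injective (n : ℕ) : Function.Injective (oddWord n) := by
  induction n with
  | zero =>
    intro s t h
    rw [oddWord_zero, oddWord_zero, ← List.append_nil (abPow _),
      ← List.append_nil (abPow (t 0))] at h
    funext i
    obtain rfl : i = 0 := Subsingleton.elim (α := Fin 1) i 0
    rw [(abPow_append_inj (by simp) (by simp) h).1]
  | succ n ih =>
    intro s t h
    rw [oddWord_succ, oddWord_succ] at h
    obtain ⟨h₀, h⟩ := abPow_append_inj (by simp) (by simp) h
    simp only [List.cons.injEq, true_and, evenWord] at h
    obtain ⟨h₁, h⟩ := abPow_append_inj (by simp) (by simp) h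
    simp only [List.cons.injEq, true_and] at h
    have h₂ := ih h
    have key (s : Fin (2 * n + 3) → ℕ) :
        s = Fin.cons (s 0) (Fin.cons (Fin.tail s 0) (Fin.tail (Fin.tail s))) := by simp
    rw [key s, key t, h₀, h₁]
    exact congrArg _ (congrArg _ h₂)

theorem shuffle_abPow (n p : ℕ) :
    shuffle (abPow n) (abPow p) =
      ∑ k ∈ Finset.range (n + 1), shuffleCoeff k n p • oddSum k (n + p) word := by
  rw [shuffle_eq_shuffleSum, shuffleSum_abPow]

open scoped Classical in
theorem coeff_word (u : List Letter) (w : FreeMonoid Letter) :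
    (word u).coeff w = if FreeMonoid.ofList u = w then 1 else 0 := by
  rw [word, MonoidAlgebra.coeff_single, Finsupp.single_apply]

theorem coeff_oddSum_word (k m : ℕ) (w : FreeMonoid Letter) :
    (oddSum k m word).coeff w = oddSum k m fun u => (word u).coeff w := by
  unfold oddSum
  split_ifs
  · rw [MonoidAlgebra.coeff_sum, Finset.sum_apply']
  · rfl

theorem coeff_shuffle_abPow (n p : ℕ) (w : FreeMonoid Letter) :
    (shuffle (abPow n) (abPow p)).coeff w =
      ∑ k ∈ Finset.range (n + 1),
        shuffleCoeff k n p • oddSum k (n + p) fun u => (word u).coeff w := by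
  rw [shuffle_abPow, MonoidAlgebra.coeff_sum, Finset.sum_apply']
  refine Finset.sum_congr rfl fun k _ => ?_
  rw [MonoidAlgebra.coeff_smul_apply, coeff_oddSum_word]

theorem coeff_word_nonneg (u : List Letter) (w : FreeMonoid Letter) : 0 ≤ (word u).coeff w := by
  rw [coeff_word]
  split_ifs <;> norm_num

open scoped Classical in
-- By the shuffle identity every word that occurs is some `oddWord k s`, and counting `aa` forces `k
-- = n`. Conversely all contributions are non-negative, so nothing cancels, and the multiplicity
-- `4^n` is positive.
theorem S_eq_image {m n : ℕ} (h : 2 * n ≤ m) :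
    S m n = (C (2 * n + 1) (m - 2 * n)).image fun s => FreeMonoid.ofList (oddWord n s) := by
  ext w
  rw [S, Finset.mem_filter, Finsupp.mem_support_iff, coeff_shuffle_abPow, Finset.mem_image,
    show n + (m - n) = m by omega]
  constructor
  · rintro ⟨hw, hcount⟩
    obtain ⟨k, -, hk⟩ := Finset.exists_ne_zero_of_sum_ne_zero hw
    have hk' : (oddSum k m fun u => (word u).coeff w) ≠ 0 := fun h0 => hk (by rw [h0, smul_zero])
    unfold oddSum at hk'
    rw [ite_ne_right_iff] at hk'
    obtain ⟨s, hs, hsw⟩ := Finset.exists_ne_zero_of_sum_ne_zero hk'.2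
    simp only [coeff_word, ite_ne_right_iff] at hsw
    obtain rfl := hsw.1
    obtain rfl : k = n := (countAA_oddWord k s).symm.trans hcount
    exact ⟨s, hs, rfl⟩
  · rintro ⟨s, hs, rfl⟩
    refine ⟨ne_of_gt ?_, countAA_oddWord n s⟩
    have hnonneg (k : ℕ) : 0 ≤ oddSum k m fun u =>
        (word u).coeff (FreeMonoid.ofList (oddWord n s)) := by
      unfold oddSum
      split_ifs
      · exact Finset.sum_nonneg fun _ _ => coeff_word_nonneg _ _
      · exact le_rfl
    refine Finset.sum_pos' (fun k _ => nsmul_nonneg (hnonneg k) _)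
      ⟨n, Finset.self_mem_range_succ n, nsmul_pos ?_ ?_⟩
    · unfold oddSum
      rw [if_pos h]
      refine Finset.sum_pos' (fun _ _ => coeff_word_nonneg _ _) ⟨s, hs, ?_⟩
      simp [coeff_word]
    · rw [shuffleCoeff_eq le_rfl (by omega)]
      simp

theorem polyIntegral_add (P Q : NCPoly) :
    polyIntegral (P + Q) = polyIntegral P + polyIntegral Q := by
  classical
  rw [polyIntegral, MonoidAlgebra.coeff_add, Finsupp.sum_add_index']
  · rfl
  · simp
  · intro w c d
    push_cast
    ring

theorem polyIntegral_zero : polyIntegral 0 = 0 := by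
  simp [polyIntegral]

theorem polyIntegral_word (w : List Letter) : polyIntegral (word w) = wordIntegral w := by
  rw [polyIntegral, word, MonoidAlgebra.coeff_single, Finsupp.sum_single_index]
  · simp
  · simp

theorem polyIntegral_T {m n : ℕ} (h : 2 * n ≤ m) :
    polyIntegral (T m n) = ∑ s ∈ C (2 * n + 1) (m - 2 * n), wordIntegral (oddWord n s) := by
  classical
  let φ : NCPoly →+ ℝ := ⟨⟨polyIntegral, polyIntegral_zero⟩, polyIntegral_add⟩
  have hφ (P : NCPoly) : polyIntegral P = φ P := rfl
  rw [T, if_pos (by omega), S_eq_image h, Finset.sum_image, hφ, map_sum]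
  · exact Finset.sum_congr rfl fun s _ => polyIntegral_word _
  · exact fun s _ t _ hst => oddWord_injective n (FreeMonoid.ofList.injective hst)

end MZV

/-! ### Iterated integrals in `[0, ∞]` and the shuffle product -/

namespace MZV

open MeasureTheory Set
open scoped ENNReal

/-- The density of a letter with values in `[0, ∞]`. -/
noncomputable def Letter.edensity (x : Letter) (t : ℝ) : ℝ≥0∞ :=
  ENNReal.ofReal (x.density t)

theorem Letter.measurable_edensity (x : Letter) : Measurable x.edensity := by
  unfold Letter.edensity
  cases x <;> simp only [Letter.density] <;> fun_prop

theorem Letter.density_nonneg (x : Letter) {t : ℝ} (ht : t ∈ Ioo (0 : ℝ) 1) : 0 ≤ x.density t := by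
  cases x
  · exact one_div_nonneg.2 ht.1.le
  · exact one_div_nonneg.2 (sub_nonneg.2 ht.2.le)

/-- The iterated integral of a word from `0` to `t`, with values in `[0, ∞]`. -/
noncomputable def iterLintegral : List Letter → ℝ → ℝ≥0∞
  | [], _ => 1
  | x :: w, t => ∫⁻ s in Ioo 0 t, x.edensity s * iterLintegral w s

theorem iterLintegral_cons (x : Letter) (w : List Letter) (t : ℝ) :
    iterLintegral (x :: w) t = ∫⁻ s in Ioo 0 t, x.edensity s * iterLintegral w s := rfl

theorem monotone_iterLintegral (w : List Letter) : Monotone (iterLintegral w) := by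
  cases w with
  | nil => exact monotone_const
  | cons x w => exact fun s t h => lintegral_mono_set (Ioo_subset_Ioo_right h)

theorem measurable_iterLintegral (w : List Letter) : Measurable (iterLintegral w) :=
  (monotone_iterLintegral w).measurable

theorem measurable_edensity_mul_iterLintegral (x : Letter) (w : List Letter) :
    Measurable fun s => x.edensity s * iterLintegral w s :=
  x.measurable_edensity.mul (measurable_iterLintegral w)

theorem shuffleSum_lintegral (u v : List Letter) (μ : Measure ℝ) (h : List Letter → ℝ → ℝ≥0∞)
    (hh : ∀ w, Measurable (h w)) :
    (∫⁻ s, shuffleSum u v (fun w => h w s) ∂μ) = shuffleSum u v fun w => ∫⁻ s, h w s ∂μ := by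
  have hm (u v : List Letter) (h : List Letter → ℝ → ℝ≥0∞) (hh : ∀ w, Measurable (h w)) :
      Measurable fun s => shuffleSum u v fun w => h w s := by
    induction u, v using shuffle.induct generalizing h with
    | case1 w => simpa only [shuffleSum_nil_left] using hh w
    | case2 x u => simpa only [shuffleSum_nil_right] using hh _
    | case3 x u y v ih₁ ih₂ =>
      simp only [shuffleSum_cons_cons]
      exact (ih₁ _ fun w => hh _).add (ih₂ _ fun w => hh _)
  induction u, v using shuffle.induct generalizing h with
  | case1 w => simp only [shuffleSum_nil_left]
  | case2 x u => simp only [shuffleSum_nil_right]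
  | case3 x u y v ih₁ ih₂ =>
    simp only [shuffleSum_cons_cons]
    rw [lintegral_add_left (hm _ _ _ fun w => hh _), ih₁ _ fun w => hh _, ih₂ _ fun w => hh _]

theorem mul_shuffleSum (c : ℝ≥0∞) (u v : List Letter) (g : List Letter → ℝ≥0∞) :
    c * shuffleSum u v g = shuffleSum u v fun w => c * g w :=
  map_shuffleSum (AddMonoidHom.mulLeft c) u v g

/-- Cut the product integral along the diagonal, which is null because points are, and apply Tonelli
to one half. -/
theorem lintegral_mul_lintegral_eq_add {μ : Measure ℝ} [SFinite μ] [NullSingletonClass μ]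
    {f g : ℝ → ℝ≥0∞}
    (hf : Measurable f) (hg : Measurable g) :
    (∫⁻ s, f s ∂μ) * ∫⁻ s, g s ∂μ =
      (∫⁻ s, f s * ∫⁻ r in Iio s, g r ∂μ ∂μ) + ∫⁻ s, g s * ∫⁻ r in Iio s, f r ∂μ ∂μ := by
  have hmono (h : ℝ → ℝ≥0∞) : Measurable fun s => ∫⁻ r in Iio s, h r ∂μ :=
    Monotone.measurable fun a b hab => lintegral_mono_set (Iio_subset_Iio hab)
  have hsplit (s : ℝ) : ∫⁻ r, g r ∂μ = (∫⁻ r in Iio s, g r ∂μ) + ∫⁻ r in Ioi s, g r ∂μ := by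
    rw [← lintegral_add_compl g (measurableSet_Iio (a := s)), compl_Iio,
      Measure.restrict_congr_set Ioi_ae_eq_Ici]
  have hswap : ∫⁻ s, f s * ∫⁻ r in Ioi s, g r ∂μ ∂μ = ∫⁻ r, g r * ∫⁻ s in Iio r, f s ∂μ ∂μ := by
    have hset : MeasurableSet {p : ℝ × ℝ | p.1 < p.2} :=
      measurableSet_lt measurable_fst measurable_snd
    have hm : Measurable ({p : ℝ × ℝ | p.1 < p.2}.indicator fun p => f p.1 * g p.2) :=
      Measurable.indicator (by fun_prop) hset
    have h := lintegral_lintegral_swap (μ := μ) (ν := μ)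
      (f := fun s r => {p : ℝ × ℝ | p.1 < p.2}.indicator (fun p => f p.1 * g p.2) (s, r))
      hm.aemeasurable
    refine Eq.trans (lintegral_congr fun s => ?_) (h.trans (lintegral_congr fun r => ?_))
    · rw [← lintegral_const_mul _ hg, ← lintegral_indicator measurableSet_Ioi]
      rfl
    · rw [← lintegral_const_mul _ hf, ← lintegral_indicator measurableSet_Iio]
      simp only [mul_comm (g r)]
      rfl
  have hm : Measurable fun s => f s * ∫⁻ r in Iio s, g r ∂μ := hf.mul (hmono g)
  rw [← lintegral_mul_const _ hf, ← hswap, ← lintegral_add_left hm]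
  exact lintegral_congr fun s => by rw [hsplit s, mul_add]

/-- Integration by parts for the product of two primitives. -/
theorem lintegral_Ioo_mul_lintegral_Ioo {f g : ℝ → ℝ≥0∞} (hf : Measurable f) (hg : Measurable g)
    (t : ℝ) :
    (∫⁻ s in Ioo 0 t, f s) * ∫⁻ s in Ioo 0 t, g s =
      (∫⁻ s in Ioo 0 t, f s * ∫⁻ r in Ioo 0 s, g r) +
        ∫⁻ s in Ioo 0 t, g s * ∫⁻ r in Ioo 0 s, f r := by
  have hIio (f g : ℝ → ℝ≥0∞) : ∫⁻ s in Ioo 0 t, f s * ∫⁻ r in Ioo 0 s, g r =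
      ∫⁻ s in Ioo 0 t, f s * ∫⁻ r in Iio s, g r ∂volume.restrict (Ioo 0 t) := by
    refine setLIntegral_congr_fun measurableSet_Ioo fun s hs => ?_
    have h : Iio s ∩ Ioo 0 t = Ioo 0 s := by
      ext r
      exact ⟨fun hr => ⟨hr.2.1, hr.1⟩, fun hr => ⟨hr.2, hr.1, hr.2.trans hs.2⟩⟩
    simp only [Measure.restrict_restrict measurableSet_Iio, h]
  rw [hIio, hIio, lintegral_mul_lintegral_eq_add hf hg]

/-- Integration by parts decides which outermost variable is larger, which is exactly the recursion
of the shuffle product. -/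
theorem iterLintegral_mul (u v : List Letter) (t : ℝ) :
    iterLintegral u t * iterLintegral v t = shuffleSum u v fun w => iterLintegral w t := by
  induction u, v using shuffle.induct generalizing t with
  | case1 w => rw [shuffleSum_nil_left, iterLintegral, one_mul]
  | case2 x u => rw [shuffleSum_nil_right, iterLintegral.eq_1, mul_one]
  | case3 x u y v ih₁ ih₂ =>
    rw [shuffleSum_cons_cons, iterLintegral_cons, iterLintegral_cons y,
      lintegral_Ioo_mul_lintegral_Ioo (measurable_edensity_mul_iterLintegral x u)
        (measurable_edensity_mul_iterLintegral y v)]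
    simp only [← iterLintegral_cons, mul_assoc]
    congr 1
    · simp only [iterLintegral_cons]
      rw [← shuffleSum_lintegral u (y :: v) _ _ fun w => measurable_edensity_mul_iterLintegral x w]
      simp only [← iterLintegral_cons, ih₁, mul_shuffleSum]
    · simp only [iterLintegral_cons y]
      rw [← shuffleSum_lintegral (x :: u) v _ _ fun w => measurable_edensity_mul_iterLintegral y w]
      simp only [mul_comm (iterLintegral v _), ih₂, mul_shuffleSum]

/-- The open simplex `t > t₁ > ⋯ > t_k > 0`. -/
def simplexBelow (k : ℕ) (t : ℝ) : Set (Fin k → ℝ) :=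
  {r | StrictAnti r ∧ ∀ j, 0 < r j ∧ r j < t}

theorem measurableSet_simplexBelow (k : ℕ) (t : ℝ) : MeasurableSet (simplexBelow k t) := by
  have h : simplexBelow k t =
      (⋂ (i : Fin k) (j : Fin k) (_ : i < j), {r : Fin k → ℝ | r j < r i}) ∩
        ⋂ j : Fin k, ({r : Fin k → ℝ | 0 < r j} ∩ {r | r j < t}) := by
    ext r
    simp [simplexBelow, StrictAnti]
  rw [h]
  refine .inter (.iInter fun i => .iInter fun j => .iInter fun _ => ?_) (.iInter fun j => ?_)
  · exact measurableSet_lt (measurable_pi_apply j) (measurable_pi_apply i)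
  · exact (measurableSet_lt measurable_const (measurable_pi_apply j)).inter
      (measurableSet_lt (measurable_pi_apply j) measurable_const)

theorem strictAnti_cons_iff {α : Type*} [Preorder α] {k : ℕ} (a : α) (r : Fin k → α) :
    StrictAnti (Fin.cons a r : Fin (k + 1) → α) ↔ StrictAnti r ∧ ∀ j, r j < a := by
  constructor
  · intro h
    exact ⟨fun i j hij => by simpa using h (Fin.succ_lt_succ_iff.2 hij),
      fun j => by simpa using h (Fin.succ_pos j)⟩
  · rintro ⟨h, ha⟩ i j hij
    induction j using Fin.cases with
    | zero => exact absurd hij (Fin.not_lt_zero _)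
    | succ j =>
      induction i using Fin.cases with
      | zero => simpa using ha j
      | succ i => simpa using h (Fin.succ_lt_succ_iff.1 hij)

theorem cons_mem_simplexBelow_iff {k : ℕ} {a t : ℝ} {r : Fin k → ℝ} :
    (Fin.cons a r : Fin (k + 1) → ℝ) ∈ simplexBelow (k + 1) t ↔
      a ∈ Ioo 0 t ∧ r ∈ simplexBelow k a := by
  simp only [simplexBelow, mem_ofPred_eq, strictAnti_cons_iff, Fin.forall_fin_succ, Fin.cons_zero,
    Fin.cons_succ, mem_Ioo]
  constructor
  · rintro ⟨⟨h, ha⟩, h₀, h₁⟩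
    exact ⟨h₀, h, fun j => ⟨(h₁ j).1, ha j⟩⟩
  · rintro ⟨h₀, h, h₁⟩
    exact ⟨⟨h, fun j => (h₁ j).2⟩, h₀, fun j => ⟨(h₁ j).1, (h₁ j).2.trans h₀.2⟩⟩

/-- Tonelli, splitting off the largest variable, which is coordinate `0`. -/
theorem lintegral_simplexBelow (w : List Letter) (t : ℝ) :
    ∫⁻ r in simplexBelow w.length t, ∏ j, (w.get j).edensity (r j) = iterLintegral w t := by
  induction w generalizing t with
  | nil =>
    have h : simplexBelow ([] : List Letter).length t = univ :=
      eq_univ_of_forall fun r => ⟨fun i => i.elim0, fun i => i.elim0⟩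
    rw [h, Measure.restrict_univ]
    simp [iterLintegral, volume_pi]
  | cons x w ih =>
    have hm (w : List Letter) : Measurable fun r : Fin w.length → ℝ =>
        ∏ j, (w.get j).edensity (r j) :=
      Finset.measurable_prod _ fun j _ =>
        (Letter.measurable_edensity _).comp (measurable_pi_apply j)
    have hm' : Measurable ((simplexBelow (w.length + 1) t).indicator
        fun r => ∏ j : Fin (w.length + 1), ((x :: w).get j).edensity (r j)) :=
      (hm (x :: w)).indicator (measurableSet_simplexBelow _ _)
    have e := (volume_preserving_piFinSuccAbove (fun _ : Fin (w.length + 1) => ℝ) 0).symm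
    change ∫⁻ r in simplexBelow (w.length + 1) t,
      ∏ j : Fin (w.length + 1), ((x :: w).get j).edensity (r j) = _
    rw [← lintegral_indicator (measurableSet_simplexBelow _ _),
      ← e.lintegral_comp hm', Measure.volume_eq_prod,
      lintegral_prod (fun z => (simplexBelow (w.length + 1) t).indicator _ _)
        (hm'.comp e.measurable).aemeasurable, iterLintegral_cons,
      ← lintegral_indicator measurableSet_Ioo]
    refine lintegral_congr fun a => ?_
    have hcons (r : Fin w.length → ℝ) :
        (MeasurableEquiv.piFinSuccAbove (fun _ : Fin (w.length + 1) => ℝ) 0).symm (a, r) =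
          Fin.cons a r := by
      simp [MeasurableEquiv.piFinSuccAbove, Fin.consEquiv]
    simp only [hcons]
    by_cases ha : a ∈ Ioo 0 t
    · rw [indicator_of_mem ha, ← ih, ← lintegral_const_mul _ (hm w),
        ← lintegral_indicator (measurableSet_simplexBelow _ _)]
      refine lintegral_congr fun r => ?_
      by_cases hr : r ∈ simplexBelow w.length a
      · rw [indicator_of_mem hr, indicator_of_mem (cons_mem_simplexBelow_iff.2 ⟨ha, hr⟩),
          Fin.prod_univ_succ]
        rfl
      · rw [indicator_of_notMem hr,
          indicator_of_notMem fun h => hr (cons_mem_simplexBelow_iff.1 h).2]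
    · rw [indicator_of_notMem ha]
      simp [indicator_of_notMem fun h => ha (cons_mem_simplexBelow_iff.1 h).1]

theorem simplex_eq_simplexBelow (k : ℕ) : simplex k = simplexBelow k 1 := rfl

theorem integrand_nonneg {w : List Letter} {t : Fin w.length → ℝ} (ht : t ∈ simplex w.length) :
    0 ≤ integrand w t :=
  Finset.prod_nonneg fun j _ => Letter.density_nonneg _ (ht.2 j)

theorem measurable_integrand (w : List Letter) : Measurable (integrand w) := by
  have h (x : Letter) : Measurable x.density := by
    cases x <;> unfold Letter.density <;> fun_prop
  exact Finset.measurable_prod _ fun j _ => (h _).comp (measurable_pi_apply j)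

theorem lintegral_integrand (w : List Letter) :
    ∫⁻ t in simplex w.length, ENNReal.ofReal (integrand w t) = iterLintegral w 1 := by
  rw [← lintegral_simplexBelow, simplex_eq_simplexBelow]
  refine setLIntegral_congr_fun (measurableSet_simplexBelow _ _) fun t ht => ?_
  exact ENNReal.ofReal_prod_of_nonneg fun j _ => Letter.density_nonneg _ (ht.2 j)

theorem ae_integrand_nonneg (w : List Letter) :
    0 ≤ᵐ[volume.restrict (simplex w.length)] integrand w :=
  (ae_restrict_iff' (measurableSet_simplexBelow _ 1)).2 (.of_forall fun _ => integrand_nonneg)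

theorem wordIntegral_eq_toReal (w : List Letter) :
    wordIntegral w = (iterLintegral w 1).toReal := by
  rw [wordIntegral, integral_eq_lintegral_of_nonneg_ae (ae_integrand_nonneg w)
    (measurable_integrand w).aestronglyMeasurable, lintegral_integrand]

theorem integrableOn_integrand {w : List Letter} (h : iterLintegral w 1 ≠ ∞) :
    IntegrableOn (integrand w) (simplex w.length) := by
  refine ⟨(measurable_integrand w).aestronglyMeasurable, ?_⟩
  rw [hasFiniteIntegral_iff_ofReal (ae_integrand_nonneg w), lintegral_integrand]
  exact h.lt_top

end MZV

/-! ### Power series expansion and multiple zeta values -/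

namespace MZV

open MeasureTheory Set
open scoped ENNReal

/-- The coefficient of `t ^ n` in the power series expansion of the iterated integral of
`zetaWord s` from `0` to `t`. -/
noncomputable def zetaCoeff : List ℕ → ℕ → ℝ≥0∞
  | [], n => if n = 0 then 1 else 0
  | k :: s, n => ((n : ℝ≥0∞) ^ k)⁻¹ * ∑ i ∈ Finset.range n, zetaCoeff s i

theorem lintegral_Ioo_ofReal_pow {t : ℝ} (ht : 0 ≤ t) (n : ℕ) :
    ∫⁻ s in Ioo 0 t, ENNReal.ofReal s ^ n = ((n + 1 : ℕ) : ℝ≥0∞)⁻¹ * ENNReal.ofReal t ^ (n + 1) := by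
  have h : ∫⁻ s in Ioo 0 t, ENNReal.ofReal s ^ n = ∫⁻ s in Ioo 0 t, ENNReal.ofReal (s ^ n) :=
    setLIntegral_congr_fun measurableSet_Ioo fun s hs => (ENNReal.ofReal_pow hs.1.le n).symm
  rw [h, ← ofReal_integral_eq_lintegral_ofReal, ← integral_Ioc_eq_integral_Ioo,
    ← intervalIntegral.integral_of_le ht, integral_pow, ← ENNReal.ofReal_natCast,
    ← ENNReal.ofReal_inv_of_pos (by positivity), ← ENNReal.ofReal_pow ht,
    ← ENNReal.ofReal_mul (by positivity)]
  · congr 1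
    push_cast
    simp [div_eq_inv_mul]
  · exact ((continuous_pow n).integrableOn_Icc (a := 0) (b := t)).mono_set Ioo_subset_Icc_self
  · exact (ae_restrict_iff' measurableSet_Ioo).2 (.of_forall fun s hs => pow_nonneg hs.1.le n)

theorem lintegral_Ioo_tsum_mul_pow {t : ℝ} (ht : 0 ≤ t) (c : ℕ → ℝ≥0∞) :
    ∫⁻ s in Ioo 0 t, ∑' n, c n * ENNReal.ofReal s ^ n =
      ∑' n, c n * (((n + 1 : ℕ) : ℝ≥0∞)⁻¹ * ENNReal.ofReal t ^ (n + 1)) := by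
  rw [lintegral_tsum fun n => by fun_prop]
  refine tsum_congr fun n => ?_
  rw [lintegral_const_mul _ (by fun_prop), lintegral_Ioo_ofReal_pow ht]

/-- Dividing by `s` and integrating multiplies the `n`th coefficient by `1/n`. Without constant term
this also holds at `n = 0`, where `∞ * 0 = 0`. -/
theorem iterLintegral_cons_a {w : List Letter} {c : ℕ → ℝ≥0∞} (h₀ : c 0 = 0)
    (hw : ∀ t ∈ Icc (0 : ℝ) 1, iterLintegral w t = ∑' n, c n * ENNReal.ofReal t ^ n)
    {t : ℝ} (ht : t ∈ Icc (0 : ℝ) 1) :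
    iterLintegral (Letter.a :: w) t = ∑' n : ℕ, (n : ℝ≥0∞)⁻¹ * c n * ENNReal.ofReal t ^ n := by
  have h : iterLintegral (Letter.a :: w) t =
      ∫⁻ s in Ioo 0 t, ∑' n, c (n + 1) * ENNReal.ofReal s ^ n := by
    refine setLIntegral_congr_fun measurableSet_Ioo fun s hs => ?_
    have hs0 : ENNReal.ofReal s ≠ 0 := by simpa using hs.1
    change _ * _ = _
    rw [hw s ⟨hs.1.le, hs.2.le.trans ht.2⟩, tsum_eq_zero_add' ENNReal.summable, h₀, zero_mul,
      zero_add, ← ENNReal.tsum_mul_left, Letter.edensity, Letter.density, one_div,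
      ENNReal.ofReal_inv_of_pos hs.1]
    refine tsum_congr fun n => ?_
    rw [mul_left_comm, pow_succ', ← mul_assoc _ (ENNReal.ofReal s),
      ENNReal.inv_mul_cancel hs0 ENNReal.ofReal_ne_top, one_mul]
  rw [h, lintegral_Ioo_tsum_mul_pow ht.1, tsum_eq_zero_add' (f := fun n : ℕ => _ * _ * _)
    ENNReal.summable, h₀]
  simp only [mul_zero, zero_mul, zero_add]
  exact tsum_congr fun n => by ring

theorem tsum_pow_mul_tsum (x : ℝ≥0∞) (c : ℕ → ℝ≥0∞) :
    (∑' k, x ^ k) * ∑' n, c n * x ^ n =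
      ∑' N, (∑ n ∈ Finset.range (N + 1), c n) * x ^ N := by
  rw [mul_comm, ← ENNReal.tsum_mul_right]
  simp only [← ENNReal.tsum_mul_left]
  rw [← ENNReal.tsum_prod, ← Finset.HasAntidiagonal.sigmaAntidiagonalEquivProd.tsum_eq,
    ENNReal.tsum_sigma']
  refine tsum_congr fun N => ?_
  rw [tsum_fintype, Finset.sum_mul,
    ← Finset.Nat.sum_antidiagonal_eq_sum_range_succ (fun i _ => c i * x ^ N)]
  refine (Finset.sum_coe_sort (Finset.HasAntidiagonal.antidiagonal N)
    fun p : ℕ × ℕ => c p.1 * x ^ p.1 * x ^ p.2).trans ?_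
  refine Finset.sum_congr rfl fun p hp => ?_
  rw [mul_assoc, ← pow_add, Finset.HasAntidiagonal.mem_antidiagonal.1 hp]

/-- Multiplying by the geometric series gives partial sums up to and including `N`; integration
moves them to `t ^ (N + 1)`. This shift produces the strict inequalities `n₁ > n₂ > ⋯`. -/
theorem iterLintegral_cons_b {w : List Letter} {c : ℕ → ℝ≥0∞}
    (hw : ∀ t ∈ Icc (0 : ℝ) 1, iterLintegral w t = ∑' n, c n * ENNReal.ofReal t ^ n)
    {t : ℝ} (ht : t ∈ Icc (0 : ℝ) 1) :
    iterLintegral (Letter.b :: w) t =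
      ∑' n : ℕ, (n : ℝ≥0∞)⁻¹ * (∑ i ∈ Finset.range n, c i) * ENNReal.ofReal t ^ n := by
  have h : iterLintegral (Letter.b :: w) t =
      ∫⁻ s in Ioo 0 t, ∑' N, (∑ n ∈ Finset.range (N + 1), c n) * ENNReal.ofReal s ^ N := by
    refine setLIntegral_congr_fun measurableSet_Ioo fun s hs => ?_
    have hs1 : s < 1 := hs.2.trans_le ht.2
    change _ * _ = _
    rw [hw s ⟨hs.1.le, hs1.le⟩, ← tsum_pow_mul_tsum, ENNReal.tsum_geometric, Letter.edensity,
      Letter.density, one_div, ENNReal.ofReal_inv_of_pos (sub_pos.2 hs1),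
      ENNReal.ofReal_sub _ hs.1.le, ENNReal.ofReal_one]
  rw [h, lintegral_Ioo_tsum_mul_pow ht.1, tsum_eq_zero_add' (f := fun n : ℕ => _ * _ * _)
    ENNReal.summable]
  simp only [Finset.range_zero, Finset.sum_empty, mul_zero, zero_mul, zero_add]
  exact tsum_congr fun n => by ring

theorem iterLintegral_replicate_a_append_b {w : List Letter} {c : ℕ → ℝ≥0∞}
    (hw : ∀ t ∈ Icc (0 : ℝ) 1, iterLintegral w t = ∑' n, c n * ENNReal.ofReal t ^ n) (k : ℕ) :
    ∀ t ∈ Icc (0 : ℝ) 1, iterLintegral (List.replicate k Letter.a ++ Letter.b :: w) t =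
      ∑' n : ℕ, ((n : ℝ≥0∞) ^ (k + 1))⁻¹ * (∑ i ∈ Finset.range n, c i) * ENNReal.ofReal t ^ n := by
  induction k with
  | zero =>
    intro t ht
    simpa using iterLintegral_cons_b hw ht
  | succ k ih =>
    intro t ht
    refine (iterLintegral_cons_a (by simp) ih ht).trans (tsum_congr fun n => ?_)
    rw [← mul_assoc, pow_succ' _ (k + 1)]
    -- At `n = 0` both sides vanish through the empty sum.
    rcases Nat.eq_zero_or_pos n with rfl | hn
    · simp
    · rw [ENNReal.mul_inv (.inl (by positivity)) (.inl (ENNReal.natCast_ne_top n))]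

theorem iterLintegral_zetaWord {s : List ℕ} (hs : ∀ k ∈ s, 0 < k) :
    ∀ t ∈ Icc (0 : ℝ) 1,
      iterLintegral (zetaWord s) t = ∑' n, zetaCoeff s n * ENNReal.ofReal t ^ n := by
  induction s with
  | nil =>
    intro t _
    rw [tsum_eq_single 0 fun n hn => by simp [zetaCoeff, hn]]
    simp [zetaWord, iterLintegral, zetaCoeff]
  | cons k s ih =>
    rw [List.forall_mem_cons] at hs
    intro t ht
    obtain ⟨j, rfl⟩ : ∃ j, k = j + 1 := ⟨k - 1, by omega⟩
    have := iterLintegral_replicate_a_append_b (ih hs.2) j t ht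
    simpa [zetaWord, zetaCoeff] using this

theorem iterLintegral_zetaWord_one {s : List ℕ} (hs : ∀ k ∈ s, 0 < k) :
    iterLintegral (zetaWord s) 1 = ∑' n, zetaCoeff s n := by
  simpa using iterLintegral_zetaWord hs 1 (right_mem_Icc.2 zero_le_one)

/-- The sum of the terms of a multiple zeta value over the tuples with entries below `N`. -/
noncomputable def zetaSumBelow (s : List ℕ) (N : ℕ∞) : ℝ≥0∞ :=
  ∑' n : Fin s.length → ℕ+,
    {n : Fin s.length → ℕ+ | StrictAnti n ∧ ∀ j, ((n j : ℕ) : ℕ∞) < N}.indicator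
    (fun n => ∏ j, (((n j : ℕ) : ℝ≥0∞) ^ s.get j)⁻¹) n

theorem zetaSumBelow_nil (N : ℕ∞) : zetaSumBelow [] N = 1 := by
  have h : {n : Fin 0 → ℕ+ | StrictAnti n ∧ ∀ j, ((n j : ℕ) : ℕ∞) < N} = univ :=
    eq_univ_of_forall fun r => ⟨fun i => i.elim0, fun i => i.elim0⟩
  simp only [zetaSumBelow, List.length_nil]
  rw [h]
  simp

theorem zetaSumBelow_cons (k : ℕ) (s : List ℕ) (N : ℕ∞) :
    zetaSumBelow (k :: s) N = ∑' a : ℕ+, {a : ℕ+ | ((a : ℕ) : ℕ∞) < N}.indicator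
      (fun a => (((a : ℕ) : ℝ≥0∞) ^ k)⁻¹ * zetaSumBelow s (a : ℕ)) a := by
  simp only [zetaSumBelow, List.length_cons]
  rw [← (Fin.consEquiv fun _ : Fin (s.length + 1) => ℕ+).tsum_eq, ENNReal.tsum_prod']
  refine tsum_congr fun a => ?_
  have hmem (n : Fin s.length → ℕ+) :
      (Fin.consEquiv fun _ : Fin (s.length + 1) => ℕ+) (a, n) ∈
          {n : Fin (s.length + 1) → ℕ+ | StrictAnti n ∧ ∀ j, ((n j : ℕ) : ℕ∞) < N} ↔
        ((a : ℕ) : ℕ∞) < N ∧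
          n ∈ {n : Fin s.length → ℕ+ | StrictAnti n ∧ ∀ j, ((n j : ℕ) : ℕ∞) < (a : ℕ)} := by
    simp only [Fin.consEquiv, Equiv.coe_fn_mk, mem_ofPred_eq, strictAnti_cons_iff,
      Fin.forall_fin_succ, Fin.cons_zero, Fin.cons_succ, Nat.cast_lt, PNat.coe_lt_coe]
    constructor
    · rintro ⟨⟨h, ha⟩, h₀, h₁⟩
      exact ⟨h₀, h, ha⟩
    · rintro ⟨h₀, h, ha⟩
      exact ⟨⟨h, ha⟩, h₀, fun j => lt_trans (by exact_mod_cast ha j) h₀⟩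
  by_cases ha : ((a : ℕ) : ℕ∞) < N
  · rw [indicator_of_mem (by exact ha), ← ENNReal.tsum_mul_left]
    refine tsum_congr fun n => ?_
    by_cases hn : n ∈ {n : Fin s.length → ℕ+ | StrictAnti n ∧ ∀ j, ((n j : ℕ) : ℕ∞) < (a : ℕ)}
    · rw [indicator_of_mem hn, indicator_of_mem ((hmem n).2 ⟨ha, hn⟩), Fin.prod_univ_succ]
      rfl
    · rw [indicator_of_notMem hn, indicator_of_notMem fun h => hn ((hmem n).1 h).2, mul_zero]
  · rw [indicator_of_notMem (by exact ha)]
    exact ENNReal.tsum_eq_zero.2 fun n => indicator_of_notMem (fun h => ha ((hmem n).1 h).1) _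

/-- Fixing the largest index gives the recursion of `zetaCoeff`: finite `N` serves the inner sums,
`⊤` the whole series. `N = 0` fails for the empty list, whose only coefficient sits at index `0`. -/
theorem zetaSumBelow_eq_tsum (s : List ℕ) {N : ℕ∞} (hN : 0 < N) :
    zetaSumBelow s N = ∑' n : ℕ, {n : ℕ | (n : ℕ∞) < N}.indicator (zetaCoeff s) n := by
  induction s generalizing N with
  | nil =>
    rw [zetaSumBelow_nil, tsum_eq_single 0 fun n hn => ?_, indicator_of_mem (by simpa using hN)]
    · simp [zetaCoeff]
    · exact indicator_apply_eq_zero.2 fun _ => by simp [zetaCoeff, hn]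
  | cons k s ih =>
    have hsum (a : ℕ+) : zetaSumBelow s (a : ℕ) = ∑ i ∈ Finset.range a, zetaCoeff s i := by
      rw [ih (by exact_mod_cast a.pos), tsum_eq_sum (s := Finset.range a) fun n hn => ?_]
      · refine Finset.sum_congr rfl fun n hn => indicator_of_mem ?_ _
        simpa using hn
      · refine indicator_of_notMem ?_ _
        simpa using hn
    rw [zetaSumBelow_cons, tsum_eq_zero_add' ENNReal.summable,
      ← tsum_pnat_eq_tsum_succ (f := fun n => indicator _ (zetaCoeff (k :: s)) n)]
    simp only [hsum]
    rw [indicator_apply_eq_zero.2 fun _ => by simp [zetaCoeff], zero_add]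
    rfl

theorem tsum_ofReal_zetaTerm (s : List ℕ) :
    ∑' n, ENNReal.ofReal (zetaTerm s n) = ∑' n, zetaCoeff s n := by
  have h₁ : ∑' n, ENNReal.ofReal (zetaTerm s n) = zetaSumBelow s ⊤ := by
    rw [zetaSumBelow, ← tsum_subtype]
    refine Eq.trans ?_ (Equiv.tsum_eq (Equiv.subtypeEquivRight (p := StrictAnti) fun n => ?_) _)
    · refine tsum_congr fun n => ?_
      rw [zetaTerm, ENNReal.ofReal_prod_of_nonneg fun j _ => by positivity]
      refine Finset.prod_congr rfl fun j _ => ?_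
      rw [ENNReal.ofReal_inv_of_pos (by have := (n.1 j).pos; positivity),
        ENNReal.ofReal_pow (by positivity), ENNReal.ofReal_natCast]
      rfl
    · simp
  rw [h₁, zetaSumBelow_eq_tsum s ENat.top_pos]
  refine tsum_congr fun n => indicator_of_mem ?_ _
  simp

theorem zetaTerm_nonneg (s : List ℕ) (n : {n : Fin s.length → ℕ+ // StrictAnti n}) :
    0 ≤ zetaTerm s n :=
  Finset.prod_nonneg fun _ _ => by positivity

theorem zeta_eq_toReal (s : List ℕ) : zeta s = (∑' n, zetaCoeff s n).toReal := by
  rw [← tsum_ofReal_zetaTerm, ENNReal.tsum_toReal_eq fun _ => ENNReal.ofReal_ne_top, zeta]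
  exact tsum_congr fun n => (ENNReal.toReal_ofReal (zetaTerm_nonneg s n)).symm

theorem summable_zetaTerm {s : List ℕ} (h : ∑' n, zetaCoeff s n ≠ ∞) : Summable (zetaTerm s) := by
  rw [← tsum_ofReal_zetaTerm] at h
  refine (ENNReal.summable_toReal h).congr fun n => ?_
  exact ENNReal.toReal_ofReal (zetaTerm_nonneg s n)

end MZV

/-! ### The value of `ζ({2}^n)` -/

namespace MZV

open MeasureTheory Set Filter Topology
open scoped ENNReal

/-- Let `y → 0` along `1/n`: the tail of the right side is at most `y` times a finite constant. -/
theorem coeff_zero_eq_of_tsum_pow_eq {a b : ℕ → ℝ≥0∞} (hb : ∑' k, b k ≠ ∞)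
    (h : ∀ y : ℝ≥0∞, y ≠ 0 → y ≤ 1 → ∑' k, a k * y ^ k ≤ ∑' k, b k * y ^ k) : a 0 ≤ b 0 := by
  have hB : ∑' k, b (k + 1) ≠ ∞ :=
    ne_top_of_le_ne_top hb (ENNReal.tsum_comp_le_tsum_of_injective (add_left_injective 1) b)
  have hy (y : ℝ≥0∞) (h₀ : y ≠ 0) (h₁ : y ≤ 1) : a 0 ≤ b 0 + y * ∑' k, b (k + 1) := by
    calc a 0 = a 0 * y ^ 0 := by simp
      _ ≤ ∑' k, a k * y ^ k := ENNReal.le_tsum 0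
      _ ≤ ∑' k, b k * y ^ k := h y h₀ h₁
      _ = b 0 + ∑' k, b (k + 1) * y ^ (k + 1) := by
        rw [tsum_eq_zero_add' ENNReal.summable, pow_zero, mul_one]
      _ ≤ b 0 + y * ∑' k, b (k + 1) := by
        rw [← ENNReal.tsum_mul_left]
        refine add_le_add_right (ENNReal.tsum_le_tsum fun k => ?_) _
        rw [pow_succ', mul_left_comm]
        exact mul_le_mul_right (mul_le_of_le_one_right' (pow_le_one' h₁ k)) y
  have ht : Tendsto (fun n : ℕ => b 0 + (n : ℝ≥0∞)⁻¹ * ∑' k, b (k + 1)) atTop (𝓝 (b 0)) := by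
    have := (ENNReal.Tendsto.mul_const ENNReal.tendsto_inv_nat_nhds_zero (.inr hB)).const_add (b 0)
    simpa using this
  refine ge_of_tendsto ht ?_
  filter_upwards [eventually_ge_atTop 1] with n hn
  exact hy _ (ENNReal.inv_ne_zero.2 (ENNReal.natCast_ne_top n))
    (ENNReal.inv_le_one.2 (by exact_mod_cast hn))

/-- Uniqueness of the coefficients of a convergent power series with non-negative coefficients. -/
theorem eq_of_tsum_pow_eq {a b : ℕ → ℝ≥0∞} (hb : ∑' k, b k ≠ ∞)
    (h : ∀ y : ℝ≥0∞, y ≠ 0 → y ≤ 1 → ∑' k, a k * y ^ k = ∑' k, b k * y ^ k) : a = b := by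
  have ha : ∑' k, a k ≠ ∞ := by
    have := h 1 one_ne_zero le_rfl
    simp only [one_pow, mul_one] at this
    rwa [this]
  funext n
  induction n generalizing a b with
  | zero =>
    exact (coeff_zero_eq_of_tsum_pow_eq hb fun y h₀ h₁ => (h y h₀ h₁).le).antisymm
      (coeff_zero_eq_of_tsum_pow_eq ha fun y h₀ h₁ => (h y h₀ h₁).ge)
  | succ n ih =>
    have h0 : a 0 = b 0 := (coeff_zero_eq_of_tsum_pow_eq hb fun y h₀ h₁ => (h y h₀ h₁).le).antisymm
      (coeff_zero_eq_of_tsum_pow_eq ha fun y h₀ h₁ => (h y h₀ h₁).ge)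
    have hshift {c : ℕ → ℝ≥0∞} (hc : ∑' k, c k ≠ ∞) : ∑' k, c (k + 1) ≠ ∞ :=
      ne_top_of_le_ne_top hc (ENNReal.tsum_comp_le_tsum_of_injective (add_left_injective 1) c)
    refine ih (a := fun k => a (k + 1)) (b := fun k => b (k + 1)) (hshift hb) ?_ (hshift ha)
    intro y h₀ h₁
    have hsplit (c : ℕ → ℝ≥0∞) : ∑' k, c k * y ^ k = c 0 + y * ∑' k, c (k + 1) * y ^ k := by
      rw [tsum_eq_zero_add' ENNReal.summable, ← ENNReal.tsum_mul_left, pow_zero, mul_one]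
      congr 1
      exact tsum_congr fun k => by ring
    have := h y h₀ h₁
    rw [hsplit a, hsplit b, h0, ENNReal.add_right_inj
      (ne_top_of_le_ne_top hb (ENNReal.le_tsum 0))] at this
    exact (ENNReal.mul_right_inj h₀ (ne_top_of_le_ne_top ENNReal.one_ne_top h₁)).1 this

/-- Euler's sine product at `ix`. -/
theorem tendsto_prod_one_add_sq_div {x : ℝ} (hx : x ≠ 0) :
    Tendsto (fun N : ℕ => ∏ j ∈ Finset.range N, (1 + x ^ 2 / ((j : ℝ) + 1) ^ 2)) atTop
      (𝓝 (Real.sinh (Real.pi * x) / (Real.pi * x))) := by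
  have hpx : (Real.pi * x : ℂ) * Complex.I ≠ 0 := by
    simp [hx, Real.pi_ne_zero]
  have h := (Complex.tendsto_euler_sin_prod (x * Complex.I)).const_mul
    (((Real.pi * x : ℂ) * Complex.I)⁻¹)
  have hlim : ((Real.pi * x : ℂ) * Complex.I)⁻¹ * Complex.sin (Real.pi * (x * Complex.I)) =
      ((Real.sinh (Real.pi * x) / (Real.pi * x) : ℝ) : ℂ) := by
    rw [← mul_assoc, Complex.sin_mul_I, mul_inv, div_eq_inv_mul]
    push_cast
    field_simp
  rw [hlim] at h
  have h' := (Complex.continuous_re.tendsto _).comp h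
  refine h'.congr fun N => ?_
  have : ((Real.pi * x : ℂ) * Complex.I)⁻¹ * (Real.pi * (x * Complex.I) *
      ∏ j ∈ Finset.range N, (1 - (x * Complex.I) ^ 2 / ((j : ℂ) + 1) ^ 2)) =
      ((∏ j ∈ Finset.range N, (1 + x ^ 2 / ((j : ℝ) + 1) ^ 2) : ℝ) : ℂ) := by
    rw [← mul_assoc (Real.pi : ℂ), ← mul_assoc, inv_mul_cancel₀ hpx, one_mul]
    push_cast
    refine Finset.prod_congr rfl fun j _ => ?_
    rw [mul_pow, Complex.I_sq]
    ring
  rw [Function.comp_apply, this, Complex.ofReal_re]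

/-- The coefficient of `y^k` in the product is an elementary symmetric function of the `1/j²`, that
is, `ζ({2}^k)` truncated to indices at most `N`. -/
theorem tsum_sum_range_zetaCoeff_replicate_two (N : ℕ) (y : ℝ≥0∞) :
    ∑' k, (∑ i ∈ Finset.range (N + 1), zetaCoeff (List.replicate k 2) i) * y ^ k =
      ∏ j ∈ Finset.range N, (1 + y * (((j + 1 : ℕ) : ℝ≥0∞) ^ 2)⁻¹) := by
  have h0 (N : ℕ) : ∑ i ∈ Finset.range (N + 1), zetaCoeff (List.replicate 0 2) i = 1 := by
    simp [zetaCoeff]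
  induction N with
  | zero =>
    rw [tsum_eq_single 0]
    · simp [zetaCoeff]
    · intro k hk
      obtain ⟨k, rfl⟩ := Nat.exists_eq_succ_of_ne_zero hk
      simp [zetaCoeff, List.replicate_succ]
  | succ N ih =>
    rw [Finset.prod_range_succ, ← ih, mul_add, mul_one, ← ENNReal.tsum_mul_right,
      tsum_eq_zero_add' ENNReal.summable, h0,
      tsum_eq_zero_add' (f := fun k => (∑ i ∈ Finset.range (N + 1), _) * y ^ k) ENNReal.summable,
      h0, add_assoc (1 * y ^ 0), ← ENNReal.tsum_add]
    congr 1
    refine tsum_congr fun k => ?_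
    rw [Finset.sum_range_succ _ (N + 1), add_mul, List.replicate_succ]
    congr 1
    rw [zetaCoeff]
    ring

theorem tsum_tsum_zetaCoeff_replicate_two {x : ℝ} (hx : 0 < x) :
    ∑' k, (∑' i, zetaCoeff (List.replicate k 2) i) * ENNReal.ofReal (x ^ 2) ^ k =
      ENNReal.ofReal (Real.sinh (Real.pi * x) / (Real.pi * x)) := by
  simp only [← ENNReal.tsum_mul_right]
  rw [ENNReal.tsum_comm]
  refine tendsto_nhds_unique ((ENNReal.tendsto_nat_tsum _).comp (tendsto_add_atTop_nat 1)) ?_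
  refine ((ENNReal.continuous_ofReal.tendsto _).comp
    (tendsto_prod_one_add_sq_div hx.ne')).congr fun N => ?_
  rw [Function.comp_apply, Function.comp_apply,
    ← Summable.tsum_finsetSum fun i _ => ENNReal.summable]
  simp only [← Finset.sum_mul]
  rw [tsum_sum_range_zetaCoeff_replicate_two,
    ENNReal.ofReal_prod_of_nonneg fun j _ => by positivity]
  refine Finset.prod_congr rfl fun j _ => ?_
  rw [ENNReal.ofReal_add zero_le_one (by positivity), ENNReal.ofReal_one, div_eq_mul_inv,
    ENNReal.ofReal_mul (by positivity), ENNReal.ofReal_inv_of_pos (by positivity),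
    ENNReal.ofReal_pow (p := (j : ℝ) + 1) (by positivity), ← ENNReal.ofReal_natCast (j + 1)]
  push_cast
  rfl

theorem hasSum_sinh_div {x : ℝ} (hx : x ≠ 0) :
    HasSum (fun k : ℕ => Real.pi ^ (2 * k) / ((2 * k + 1).factorial : ℝ) * (x ^ 2) ^ k)
      (Real.sinh (Real.pi * x) / (Real.pi * x)) := by
  have h := (Real.hasSum_sinh (Real.pi * x)).div_const (Real.pi * x)
  convert! h using 2 with k
  have hpx : Real.pi * x ≠ 0 := mul_ne_zero Real.pi_ne_zero hx
  field_simp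
  ring

/-- The evaluation `ζ({2}ⁿ) = π^{2n} / (2n+1)!`. -/
theorem tsum_zetaCoeff_replicate_two (n : ℕ) :
    ∑' i, zetaCoeff (List.replicate n 2) i =
      ENNReal.ofReal (Real.pi ^ (2 * n) / ((2 * n + 1).factorial : ℝ)) := by
  have hsum {x : ℝ} (hx : 0 < x) :
      ∑' k : ℕ, ENNReal.ofReal (Real.pi ^ (2 * k) / ((2 * k + 1).factorial : ℝ)) *
        ENNReal.ofReal (x ^ 2) ^ k = ENNReal.ofReal (Real.sinh (Real.pi * x) / (Real.pi * x)) := by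
    rw [← (hasSum_sinh_div hx.ne').tsum_eq,
      ENNReal.ofReal_tsum_of_nonneg (fun k => by positivity) (hasSum_sinh_div hx.ne').summable]
    refine tsum_congr fun k => ?_
    rw [ENNReal.ofReal_mul (by positivity), ENNReal.ofReal_pow (sq_nonneg x)]
  refine congrFun (eq_of_tsum_pow_eq
    (a := fun n => ∑' i, zetaCoeff (List.replicate n 2) i)
    (b := fun n => ENNReal.ofReal (Real.pi ^ (2 * n) / ((2 * n + 1).factorial : ℝ))) ?_ ?_) n
  · have := hsum one_pos
    simp only [one_pow, ENNReal.ofReal_one, mul_one] at this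
    rw [this]
    exact ENNReal.ofReal_ne_top
  · intro y h₀ h₁
    have hy : y ≠ ∞ := ne_top_of_le_ne_top ENNReal.one_ne_top h₁
    have hpos : 0 < y.toReal := ENNReal.toReal_pos h₀ hy
    have h := (tsum_tsum_zetaCoeff_replicate_two (Real.sqrt_pos.2 hpos)).trans
      (hsum (Real.sqrt_pos.2 hpos)).symm
    rwa [Real.sq_sqrt hpos.le, ENNReal.ofReal_toReal hy] at h

/-! ### The binomial identity -/

open Polynomial in
-- Compare coefficients of `X^{2n+1}` in `(1+X)^{2m+2} = (2X + (1+X²))^{m+1}`. Only odd powers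
-- `(2X)^{2k+1}` contribute, with `2^{2k+1} = 4^k * 2`.
theorem sum_four_pow_mul_choose {m n : ℕ} (h : 2 * n ≤ m) :
    ∑ k ∈ Finset.range (n + 1), 4 ^ k * (m - 2 * k).choose (n - k) *
      (2 * (m + 1).choose (2 * k + 1)) = (2 * m + 2).choose (2 * n + 1) := by
  have hpoly : ((1 + X) ^ (2 * m + 2) : ℕ[X]) =
      ∑ j ∈ Finset.range (m + 2),
        ((2 ^ j * (m + 1).choose j : ℕ) : ℕ[X]) * (X ^ j * expand ℕ 2 ((1 + X) ^ (m + 1 - j))) := by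
    rw [show 2 * m + 2 = 2 * (m + 1) by ring, pow_mul,
      show ((1 + X) ^ 2 : ℕ[X]) = 2 * X + (1 + X ^ 2) by ring, add_pow]
    refine Finset.sum_congr rfl fun j _ => ?_
    simp only [map_pow, map_add, map_one, expand_X]
    push_cast
    ring
  have hcoeff := congrArg (fun p => p.coeff (2 * n + 1)) hpoly
  simp only [coeff_one_add_X_pow, finsetSum_coeff, coeff_natCast_mul, Nat.cast_id] at hcoeff
  rw [hcoeff]
  refine Finset.sum_of_injOn (fun k => 2 * k + 1) (fun a _ b _ hab => by simpa using hab) ?_ ?_ ?_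
  · intro k hk
    simp only [Finset.coe_range, mem_Iio] at hk ⊢
    omega
  · intro j _ hj
    rw [coeff_X_pow_mul', coeff_expand two_pos]
    split_ifs with h₁ h₂
    · exact absurd ⟨(j - 1) / 2, by simp only [Finset.coe_range, mem_Iio]; omega,
        by simp only []; omega⟩ hj
    · simp
    · simp
  · intro k hk
    rw [Finset.mem_range] at hk
    rw [coeff_X_pow_mul', coeff_expand two_pos, if_pos (by omega), if_pos (by omega),
      coeff_one_add_X_pow, show (2 * n + 1 - (2 * k + 1)) / 2 = n - k by omega,
      show m + 1 - (2 * k + 1) = m - 2 * k by omega, pow_succ, pow_mul, Nat.cast_id]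
    ring

/-! ### Solving the integrated shuffle relations -/

theorem insertTwos_pos {n : ℕ} (s : Fin (2 * n + 1) → ℕ) : ∀ k ∈ insertTwos s, 0 < k := by
  intro k hk
  simp only [insertTwos, List.mem_append, List.mem_flatMap, List.mem_cons,
    List.mem_replicate] at hk
  rcases hk with h | ⟨i, -, (h | h) | h | h⟩ <;> omega

theorem iterLintegral_abPow_one (n : ℕ) :
    iterLintegral (abPow n) 1 =
      ENNReal.ofReal (Real.pi ^ (2 * n) / ((2 * n + 1).factorial : ℝ)) := by
  rw [← zetaWord_replicate_two, iterLintegral_zetaWord_one fun k hk => by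
    rw [(List.mem_replicate.1 hk).2]; norm_num, tsum_zetaCoeff_replicate_two]

theorem iterLintegral_oddWord_one {n : ℕ} (s : Fin (2 * n + 1) → ℕ) :
    iterLintegral (oddWord n s) 1 = ∑' i, zetaCoeff (insertTwos s) i :=
  iterLintegral_zetaWord_one (insertTwos_pos s)

/-- The claimed values of the `∫ T_{m,k}` satisfy the integrated shuffle relation. -/
theorem sum_shuffleCoeff_mul {m n : ℕ} (h : 2 * n ≤ m) :
    ∑ k ∈ Finset.range (n + 1), (shuffleCoeff k n (m - n) : ℝ) *
      (2 * Real.pi ^ (2 * m) / ((2 * m + 2).factorial : ℝ) * ((m + 1).choose (2 * k + 1) : ℝ)) =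
    Real.pi ^ (2 * n) / ((2 * n + 1).factorial : ℝ) *
      (Real.pi ^ (2 * (m - n)) / ((2 * (m - n) + 1).factorial : ℝ)) := by
  obtain ⟨p, rfl⟩ := Nat.exists_eq_add_of_le (show n ≤ m by omega)
  have hchoose := congrArg (Nat.cast (R := ℝ)) (sum_four_pow_mul_choose h)
  have hfact := congrArg (Nat.cast (R := ℝ))
    (Nat.add_choose_mul_factorial_mul_factorial (2 * p + 1) (2 * n + 1))
  rw [show 2 * p + 1 + (2 * n + 1) = 2 * (n + p) + 2 by ring] at hfact
  push_cast at hchoose hfact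
  rw [← hchoose] at hfact
  rw [Nat.add_sub_cancel_left, ← hfact]
  -- This sum is now a factor of the denominator that replaced `(2m+2)!`, so it must be nonzero to
  -- cancel.
  have hne : ∑ k ∈ Finset.range (n + 1), (4 : ℝ) ^ k * ((n + p - 2 * k).choose (n - k) : ℝ) *
      (2 * ((n + p + 1).choose (2 * k + 1) : ℝ)) ≠ 0 := by
    intro h0
    rw [h0, zero_mul, zero_mul] at hfact
    exact Nat.cast_ne_zero.2 (Nat.factorial_ne_zero _) hfact.symm
  have hmul (D : ℝ) : ∑ k ∈ Finset.range (n + 1), (shuffleCoeff k n p : ℝ) *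
      (2 * Real.pi ^ (2 * (n + p)) / D * ((n + p + 1).choose (2 * k + 1) : ℝ)) =
      (∑ k ∈ Finset.range (n + 1), (4 : ℝ) ^ k * ((n + p - 2 * k).choose (n - k) : ℝ) *
        (2 * ((n + p + 1).choose (2 * k + 1) : ℝ))) * (Real.pi ^ (2 * (n + p)) / D) := by
    rw [Finset.sum_mul]
    refine Finset.sum_congr rfl fun k hk => ?_
    rw [Finset.mem_range] at hk
    rw [shuffleCoeff_eq (by omega) (by omega)]
    push_cast
    ring
  rw [hmul]
  clear hchoose hfact hmul
  generalize ∑ k ∈ Finset.range (n + 1), (4 : ℝ) ^ k * ((n + p - 2 * k).choose (n - k) : ℝ) *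
    (2 * ((n + p + 1).choose (2 * k + 1) : ℝ)) = A at hne ⊢
  have hfact₁ : ((2 * n + 1).factorial : ℝ) ≠ 0 := Nat.cast_ne_zero.2 (Nat.factorial_ne_zero _)
  have hfact₂ : ((2 * p + 1).factorial : ℝ) ≠ 0 := Nat.cast_ne_zero.2 (Nat.factorial_ne_zero _)
  field_simp
  ring

/-- The sum of the iterated integrals of the words `oddWord n s` of length `2 * m`. -/
theorem oddSum_iterLintegral {m n : ℕ} (h : 2 * n ≤ m) :
    oddSum n m (fun w => iterLintegral w 1) =
      ENNReal.ofReal (2 * Real.pi ^ (2 * m) / ((2 * m + 2).factorial : ℝ) *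
        ((m + 1).choose (2 * n + 1) : ℝ)) := by
  induction n using Nat.strong_induction_on with
  | _ n ih =>
    -- The relation involves only `k ≤ n`. The terms `k < n` are known and finite, so they cancel
    -- even in `[0, ∞]`; then divide by the coefficient `4^n` of the last one.
    have hshuffle := iterLintegral_mul (abPow n) (abPow (m - n)) 1
    rw [iterLintegral_abPow_one, iterLintegral_abPow_one, shuffleSum_abPow,
      ← ENNReal.ofReal_mul (by positivity), ← sum_shuffleCoeff_mul h,
      ENNReal.ofReal_sum_of_nonneg fun k _ => by positivity, Finset.sum_range_succ,
      Finset.sum_range_succ, show n + (m - n) = m by omega] at hshuffle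
    have hterm (k : ℕ) (x : ℝ) : ENNReal.ofReal ((shuffleCoeff k n (m - n) : ℝ) * x) =
        shuffleCoeff k n (m - n) • ENNReal.ofReal x := by
      rw [← nsmul_eq_mul, ENNReal.ofReal_nsmul]
    simp only [hterm] at hshuffle
    rw [Finset.sum_congr (g := fun k => shuffleCoeff k n (m - n) •
        oddSum k m fun w => iterLintegral w 1) rfl fun k hk => by
      rw [Finset.mem_range] at hk
      rw [ih k hk (by omega)]] at hshuffle
    have hfin : ∑ k ∈ Finset.range n, shuffleCoeff k n (m - n) •
        oddSum k m (fun w => iterLintegral w 1) ≠ ∞ := by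
      refine ENNReal.sum_ne_top.2 fun k hk => ?_
      rw [Finset.mem_range] at hk
      rw [ih k hk (by omega), nsmul_eq_mul]
      exact ENNReal.mul_ne_top (ENNReal.natCast_ne_top _) ENNReal.ofReal_ne_top
    rw [ENNReal.add_right_inj hfin, nsmul_eq_mul, nsmul_eq_mul, ENNReal.mul_right_inj ?_
      (ENNReal.natCast_ne_top _)] at hshuffle
    · exact hshuffle.symm
    · rw [shuffleCoeff_eq le_rfl (by omega)]
      simp

/-- All convergence claims rest on this: each term of a finite total in `[0, ∞]` is finite. -/
theorem iterLintegral_oddWord_ne_top {m n : ℕ} (h : 2 * n ≤ m) {s : Fin (2 * n + 1) → ℕ}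
    (hs : s ∈ C (2 * n + 1) (m - 2 * n)) : iterLintegral (oddWord n s) 1 ≠ ∞ := by
  have hsum := oddSum_iterLintegral h
  rw [oddSum, if_pos h] at hsum
  have hfin := hsum.trans_ne ENNReal.ofReal_ne_top
  exact ENNReal.sum_ne_top.1 hfin s hs

theorem Z_eq_wordIntegral {n : ℕ} (s : Fin (2 * n + 1) → ℕ) :
    Z s = wordIntegral (oddWord n s) := by
  rw [Z, zeta_eq_toReal, wordIntegral_eq_toReal, iterLintegral_oddWord_one]

theorem sum_Z {m n : ℕ} (h : 2 * n ≤ m) :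
    ∑ s ∈ C (2 * n + 1) (m - 2 * n), Z s =
      2 * Real.pi ^ (2 * m) / ((2 * m + 2).factorial : ℝ) * ((m + 1).choose (2 * n + 1) : ℝ) := by
  have hsum := oddSum_iterLintegral h
  rw [oddSum, if_pos h] at hsum
  rw [← ENNReal.toReal_ofReal (r := 2 * Real.pi ^ (2 * m) / _ * _) (by positivity), ← hsum,
    ENNReal.toReal_sum fun s hs => iterLintegral_oddWord_ne_top h hs]
  exact Finset.sum_congr rfl fun s _ => by rw [Z_eq_wordIntegral, wordIntegral_eq_toReal]

theorem Z₁_eq (m : ℕ) : Z₁ m = Real.pi ^ (2 * m) / ((2 * m + 1).factorial : ℝ) := by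
  rw [Z₁, Z_eq_wordIntegral, wordIntegral_eq_toReal, oddWord_zero, iterLintegral_abPow_one,
    ENNReal.toReal_ofReal (by positivity)]

theorem Z₁_div_mul_choose (m n : ℕ) :
    Z₁ m / (2 * (n : ℝ) + 1) * (m.choose (2 * n) : ℝ) =
      2 * Real.pi ^ (2 * m) / ((2 * m + 2).factorial : ℝ) * ((m + 1).choose (2 * n + 1) : ℝ) := by
  have h := congrArg (Nat.cast (R := ℝ)) (Nat.add_one_mul_choose_eq m (2 * n))
  push_cast at h
  have hfact : ((2 * m + 1).factorial : ℝ) ≠ 0 := Nat.cast_ne_zero.2 (Nat.factorial_ne_zero _)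
  have hn : (2 * (n : ℝ) + 1) ≠ 0 := by positivity
  have hm : (2 * (m : ℝ) + 2) ≠ 0 := by positivity
  have hchoose : (m.choose (2 * n) : ℝ) =
      ((m + 1).choose (2 * n + 1) : ℝ) * (2 * n + 1) / (m + 1) := by
    rw [eq_div_iff (by positivity), ← h, mul_comm]
  rw [Z₁_eq, hchoose, Nat.factorial_succ (2 * m + 1)]
  push_cast
  field_simp
  ring

theorem threeOne_eq_insertTwos (n : ℕ) :
    threeOne n = insertTwos (n := n) fun _ => 0 := by
  induction n with
  | zero => rfl
  | succ n ih => rw [insertTwos_succ, ← ih]; rfl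

end MZV

theorem mainTheorem1 :
    (∀ m n : ℕ, 2 * n ≤ m →
      (∀ s ∈ MZV.C (2 * n + 1) (m - 2 * n), Summable (MZV.zetaTerm (MZV.insertTwos s))) ∧
      (∀ w ∈ MZV.S m n, MeasureTheory.IntegrableOn (MZV.integrand w.toList)
        (MZV.simplex w.toList.length)) ∧
      ∑ s ∈ MZV.C (2 * n + 1) (m - 2 * n), MZV.Z s = MZV.polyIntegral (MZV.T m n) ∧
      MZV.polyIntegral (MZV.T m n) = MZV.Z₁ m / (2 * (n : ℝ) + 1) * (m.choose (2 * n) : ℝ) ∧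
      MZV.Z₁ m / (2 * (n : ℝ) + 1) * (m.choose (2 * n) : ℝ) =
        2 * Real.pi ^ (2 * m) / ((2 * m + 2).factorial : ℝ) *
          ((m + 1).choose (2 * n + 1) : ℝ)) ∧
    (∀ n : ℕ,
      Summable (MZV.zetaTerm (MZV.threeOne n)) ∧
      MZV.zeta (MZV.threeOne n) = 2 * Real.pi ^ (4 * n) / ((4 * n + 2).factorial : ℝ)) := by
  classical
  have hsummable (m n : ℕ) (h : 2 * n ≤ m) (s) (hs : s ∈ MZV.C (2 * n + 1) (m - 2 * n)) :
      Summable (MZV.zetaTerm (MZV.insertTwos s)) :=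
    MZV.summable_zetaTerm
      (MZV.iterLintegral_oddWord_one s ▸ MZV.iterLintegral_oddWord_ne_top h hs)
  refine ⟨fun m n h => ?_, fun n => ?_⟩
  · have hT : ∑ s ∈ MZV.C (2 * n + 1) (m - 2 * n), MZV.Z s = MZV.polyIntegral (MZV.T m n) := by
      rw [MZV.polyIntegral_T h]
      exact Finset.sum_congr rfl fun s _ => MZV.Z_eq_wordIntegral s
    refine ⟨hsummable m n h, fun w hw => ?_, hT, ?_, MZV.Z₁_div_mul_choose m n⟩
    · rw [MZV.S_eq_image h, Finset.mem_image] at hw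
      obtain ⟨s, hs, rfl⟩ := hw
      exact MZV.integrableOn_integrand (MZV.iterLintegral_oddWord_ne_top h hs)
    · rw [← hT, MZV.sum_Z h, MZV.Z₁_div_mul_choose]
  · have hC : MZV.C (2 * n + 1) (2 * n - 2 * n) = {fun _ => 0} := by
      rw [Nat.sub_self]
      exact Finset.Nat.antidiagonalTuple_zero_right _
    rw [MZV.threeOne_eq_insertTwos]
    refine ⟨hsummable (2 * n) n le_rfl _ (by rw [hC, Finset.mem_singleton]), ?_⟩
    have h := MZV.sum_Z (le_refl (2 * n))
    rw [hC, Finset.sum_singleton, Nat.choose_self, Nat.cast_one, mul_one,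
      show 2 * (2 * n) = 4 * n by ring] at h
    exact h
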